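/- Let $\mathrm{B}(\varepsilon)$ be the binary symmetric channel with crossover probability $\varepsilon$, and for $p_j\ge 0$ with $\sum_j p_j=1$ let $\sum_j p_j\mathrm{B}(\varepsilon_j)$ be the channel with uniform binary input that uses $\mathrm{B}(\varepsilon_j)$ with probability $p_j$ and reveals $j$ at the output. Binary-input discrete memoryless channels are considered up to equivalence $\cong$, i.e. equality of likelihood-ratio profiles ($P_W(\varepsilon)$, $\varepsilon\in[0,1]$, is the probability that the output $y$ of $W$ satisfies $\Pr(y|0)/\Pr(y|1)=\varepsilon/(1-\varepsilon)$). $I(W)$ denotes the symmetric capacity (the mutual information between the uniform input and the output, in bits). Let $2\le n<m$ and $Q\cong\sum_{i=1}^m q_i\mathrm{B}(\sigma_i)$ with $q_i>0$, $\sum_i q_i=1$ and $0\le\sigma_1<\cdots<\sigma_m\le 1/2$; put $q_0=q_{m+1}=0$. For $1\le i_2<\cdots<i_n\le m$ and $0\le s_j\le q_{i_j}$ ($2\le j\le n$), put $i_1=s_1=s_{n+1}=0$, $i_{n+1}=m+1$, and let $D_Q(i_2,\dots,i_n;s_2,\dots,s_n)=\sum_{j=1}^n p_j\mathrm{B}(\varepsilon_j)$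 with $$p_j=s_j+\sum_{i_j<i<i_{j+1}}q_i+(q_{i_{j+1}}-s_{j+1}),\qquad p_j\varepsilon_j=s_j\sigma_{i_j}+\sum_{i_j<i<i_{j+1}}q_i\sigma_i+(q_{i_{j+1}}-s_{j+1})\sigma_{i_{j+1}}$$ (the terms with $\sigma_0$ and $\sigma_{m+1}$ have coefficient $0$). The pairs $(i_j,s_j)$ are its splitting patterns. It is a *$2n$-$P^*$-degradation* of $Q$ if all $p_j>0$, $0\le\varepsilon_1<\cdots<\varepsilon_n\le 1/2$, and for every $j\in\{1,\dots,n\}$ with $i_{j+1}=i_j+1$: if $s_j=0$ then $s_{j+1}=0$, $p_j=q_{i_{j+1}}$ and $\varepsilon_j=\sigma_{i_{j+1}}$; if $s_{j+1}=q_{i_{j+1}}$ then $s_j=q_{i_j}$, $p_j=q_{i_j}$ and $\varepsilon_j=\sigma_{i_j}$. It is a *$2n$-$P^+$-degradation* if moreover $s_j\in\{0,q_{i_j}\}$ for $2\le j\le n$. For $1=k_0<k_1<\cdots<k_n=m+1$ let $D_Q^+(k_1,\dots,k_{n-1})=\sum_{j=1}^n p_j\mathrm{B}(\varepsilon_j)$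 with $p_j=\sum_{k_{j-1}\le i<k_j}q_i$ and $p_j\varepsilon_j=\sum_{k_{j-1}\le i<k_j}q_i\sigma_i$. The capacity-loss rate of $W$ is $(I(Q)-I(W))/I(Q)$. One $2n$-$P^*$-degradation is *better* than another if its capacity-loss rate is strictly smaller, and it is *C-optimal* if its capacity-loss rate is minimal among all $2n$-$P^*$-degradations of $Q$. Let $$\phi(\varepsilon,\varepsilon')=\frac{\ln\frac{1-\varepsilon}{1-\varepsilon'}}{\ln\frac{(1-\varepsilon)\varepsilon'}{(1-\varepsilon')\varepsilon}}\quad(0<\varepsilon<\varepsilon'\le 1/2),\qquad \phi(0,\varepsilon')=0 .$$ 1. Every C-optimal $2n$-degradation $W$ of $Q$ is a $2n$-$P^+$-degradation of $Q$; indeed, whenever $W\cong D_Q(i_2,\dots,i_n;s_2,\dots,s_n)$ is a representation of $W$ as a $2n$-$P^*$-degradation, then $s_j\in\{0,q_{i_j}\}$ for all $j=2,\dots,n$. 2. Let $W=D_Q^+(k_1,\dots,k_{n-1})=\sum_{j=1}^n p_j\mathrm{B}(\varepsilon_j)$ with $1=k_0<k_1<\cdots<k_n=m+1$, and let $1\le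 j\le n-1$. (a) If $\phi(\varepsilon_j,\varepsilon_{j+1})\ge\sigma_{k_j}$, then replacing $k_j$ by $k_j+1$ again gives a strictly increasing sequence from $1$ to $m+1$, and $D_Q^+$ of it is a $2n$-$P^+$-degradation of $Q$ that is better than $W$. (b) If $\phi(\varepsilon_j,\varepsilon_{j+1})\le\sigma_{k_j-1}$ and $\varepsilon_j+\sigma_{k_j-1}>0$, then the same holds for replacing $k_j$ by $k_j-1$. -/

import Mathlib

namespace SymBIDMC

/-- `W : ZMod 2 → Y → ℝ`, with `W x y = Pr(y | x)`, is a binary-input discrete memoryless channel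
with output alphabet `Y` (the input is uniform on `ZMod 2`). -/
structure IsBIDMC {Y : Type*} (W : ZMod 2 → Y → ℝ) : Prop where
  nonneg : ∀ x y, 0 ≤ W x y
  hasSum_one : ∀ x, HasSum (W x) 1

/-- The symmetric capacity `I(W)`, the mutual information of the uniform input and the output. -/
noncomputable def symmCapacity {Y : Type*} (W : ZMod 2 → Y → ℝ) : ℝ :=
  ∑' y, ∑ x : ZMod 2,
    (1 / 2 : ℝ) * W x y * Real.logb 2 (W x y / ((1 / 2 : ℝ) * W 0 y + (1 / 2 : ℝ) * W 1 y))

/-- The likelihood-ratio profile `P_W(ε)`: the probability that the output `y` has likelihood ratio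
`Pr(y | 0) / Pr(y | 1) = ε / (1 - ε)` (cross-multiplied, so that the ratio may be infinite;
outputs of probability zero contribute nothing). -/
noncomputable def lrProfile {Y : Type*} (W : ZMod 2 → Y → ℝ) (ε : ℝ) : ℝ :=
  ∑' y : {y : Y // W 0 y * (1 - ε) = W 1 y * ε}, (W 0 y + W 1 y) / 2

/-- Equivalence `W ≅ W'` of channels: the likelihood-ratio profiles coincide on `[0, 1]`. -/
def ChannelEquiv {Y Y' : Type*} (W : ZMod 2 → Y → ℝ) (W' : ZMod 2 → Y' → ℝ) : Prop :=
  ∀ ε ∈ Set.Icc (0 : ℝ) 1, lrProfile W ε = lrProfile W' ε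

/-- The binary symmetric channel `B(ε)`. -/
noncomputable def bsc (ε : ℝ) : ZMod 2 → ZMod 2 → ℝ :=
  fun x y => if y = x then 1 - ε else ε

/-- The random switching channel `∑_{j ∈ [n]} p_j B(ε_j)`; the families `p`, `ε` are indexed
from `1` to `n`. -/
noncomputable def bscMixture (n : ℕ) (p ε : ℕ → ℝ) : ZMod 2 → Fin n × ZMod 2 → ℝ :=
  fun x y => p (y.1 + 1) * bsc (ε (y.1 + 1)) x y.2

/-- The data of a symmetric channel `∑_{i ∈ [m]} q_i B(σ_i)` in normal form, i.e. of a
member of `𝔹*_m`, with the convention `q_0 = q_{m+1} = 0`. -/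
structure IsNormalForm (m : ℕ) (q σ : ℕ → ℝ) : Prop where
  q_zero : q 0 = 0
  q_last : q (m + 1) = 0
  q_pos : ∀ i ∈ Finset.Icc 1 m, 0 < q i
  q_sum : ∑ i ∈ Finset.Icc 1 m, q i = 1
  σ_nonneg : ∀ i ∈ Finset.Icc 1 m, 0 ≤ σ i
  σ_lt : ∀ i i', 1 ≤ i → i < i' → i' ≤ m → σ i < σ i'
  σ_le : ∀ i ∈ Finset.Icc 1 m, σ i ≤ 1 / 2

/-- The weight `r_l`, `a ≤ l ≤ b`, of `B(σ_l)` in the `(a, b; t, t')`-segment of the mixture. -/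
noncomputable def segCoeff (q : ℕ → ℝ) (a b : ℕ) (t t' : ℝ) (l : ℕ) : ℝ :=
  if l = a then t else if l = b then q b - t' else q l

/-- The weight `p_j` of the particle compounded from the `j`-th segment
`(i_j, i_{j+1}; s_j, s_{j+1})`. -/
noncomputable def segWeight (q : ℕ → ℝ) (i : ℕ → ℕ) (s : ℕ → ℝ) (j : ℕ) : ℝ :=
  ∑ l ∈ Finset.Icc (i j) (i (j + 1)), segCoeff q (i j) (i (j + 1)) (s j) (s (j + 1)) l

/-- The crossover probability `ε_j` of the particle compounded from the `j`-th segment. -/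
noncomputable def segMean (q σ : ℕ → ℝ) (i : ℕ → ℕ) (s : ℕ → ℝ) (j : ℕ) : ℝ :=
  (∑ l ∈ Finset.Icc (i j) (i (j + 1)),
    segCoeff q (i j) (i (j + 1)) (s j) (s (j + 1)) l * σ l) / segWeight q i s j

/-- The channel `D_Q(i_2, …, i_n; s_2, …, s_n) = ∑_{j ∈ [n]} p_j B(ε_j)`. -/
noncomputable def segChannel (n : ℕ) (q σ : ℕ → ℝ) (i : ℕ → ℕ) (s : ℕ → ℝ) :
    ZMod 2 → Fin n × ZMod 2 → ℝ :=
  bscMixture n (segWeight q i s) (segMean q σ i s)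

/-- The splitting patterns `(i_2, s_2), …, (i_n, s_n)`, extended by `i_1 = s_1 = 0`,
`i_{n+1} = m + 1`, `s_{n+1} = 0`, define a `2n`-`P*`-degradation
`D_Q(i_2, …, i_n; s_2, …, s_n)` of `Q = ∑ q_i B(σ_i)`. -/
structure IsPStarPattern (m n : ℕ) (q σ : ℕ → ℝ) (i : ℕ → ℕ) (s : ℕ → ℝ) : Prop where
  i_one : i 1 = 0
  s_one : s 1 = 0
  i_last : i (n + 1) = m + 1
  s_last : s (n + 1) = 0
  i_lt : ∀ j ∈ Finset.Icc 1 n, i j < i (j + 1)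
  s_nonneg : ∀ j ∈ Finset.Icc 2 n, 0 ≤ s j
  s_le : ∀ j ∈ Finset.Icc 2 n, s j ≤ q (i j)
  weight_pos : ∀ j ∈ Finset.Icc 1 n, 0 < segWeight q i s j
  mean_nonneg : 0 ≤ segMean q σ i s 1
  mean_lt : ∀ j ∈ Finset.Ico 1 n, segMean q σ i s j < segMean q σ i s (j + 1)
  mean_le : segMean q σ i s n ≤ 1 / 2
  adjacent_left : ∀ j ∈ Finset.Icc 1 n, i (j + 1) = i j + 1 → s j = 0 →
    s (j + 1) = 0 ∧ segWeight q i s j = q (i (j + 1)) ∧ segMean q σ i s j = σ (i (j + 1))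
  adjacent_right : ∀ j ∈ Finset.Icc 1 n, i (j + 1) = i j + 1 → s (j + 1) = q (i (j + 1)) →
    s j = q (i j) ∧ segWeight q i s j = q (i j) ∧ segMean q σ i s j = σ (i j)

/-- `W` is (a channel equivalent to) a `2n`-`P*`-degradation of `∑_{i ∈ [m]} q_i B(σ_i)`. -/
def IsPStarDegradation (m n : ℕ) (q σ : ℕ → ℝ) {Y : Type*} (W : ZMod 2 → Y → ℝ) : Prop :=
  IsBIDMC W ∧ ∃ (i : ℕ → ℕ) (s : ℕ → ℝ),
    IsPStarPattern m n q σ i s ∧ ChannelEquiv W (segChannel n q σ i s)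

/-- `W` is (a channel equivalent to) a `2n`-`P⁺`-degradation of `∑_{i ∈ [m]} q_i B(σ_i)`: a
`2n`-`P*`-degradation whose splitting patterns have `s_j ∈ {0, q_{i_j}}`. -/
def IsPPlusDegradation (m n : ℕ) (q σ : ℕ → ℝ) {Y : Type*} (W : ZMod 2 → Y → ℝ) : Prop :=
  IsBIDMC W ∧ ∃ (i : ℕ → ℕ) (s : ℕ → ℝ),
    IsPStarPattern m n q σ i s ∧ (∀ j ∈ Finset.Icc 2 n, s j = 0 ∨ s j = q (i j)) ∧
      ChannelEquiv W (segChannel n q σ i s)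

/-- The capacity-loss rate `(I(Q) - I(W)) / I(Q)`. -/
noncomputable def clr {X Y : Type*} (Q : ZMod 2 → X → ℝ) (W : ZMod 2 → Y → ℝ) : ℝ :=
  (symmCapacity Q - symmCapacity W) / symmCapacity Q

/-- `W'` is a better `2n`-`P*`-degradation of `Q ≅ ∑_{i ∈ [m]} q_i B(σ_i)` than `W`. -/
def IsBetter (m n : ℕ) (q σ : ℕ → ℝ) {X Y Y' : Type*} (Q : ZMod 2 → X → ℝ)
    (W' : ZMod 2 → Y' → ℝ) (W : ZMod 2 → Y → ℝ) : Prop :=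
  IsPStarDegradation m n q σ W' ∧ IsPStarDegradation m n q σ W ∧ clr Q W' < clr Q W

/-- `W` is a C-optimal `2n`-degradation of `Q ≅ ∑_{i ∈ [m]} q_i B(σ_i)`: its capacity-loss rate
is minimal among the `2n`-`P*`-degradations. -/
def IsCOptimal (m n : ℕ) (q σ : ℕ → ℝ) {X Y : Type*} (Q : ZMod 2 → X → ℝ)
    (W : ZMod 2 → Y → ℝ) : Prop :=
  IsPStarDegradation m n q σ W ∧
    ∀ (Y' : Type) (W' : ZMod 2 → Y' → ℝ), IsPStarDegradation m n q σ W' → clr Q W ≤ clr Q W'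

/-- `1 = k_0 < k_1 < ⋯ < k_n = m + 1`. -/
structure IsCutSequence (m n : ℕ) (k : ℕ → ℕ) : Prop where
  zero : k 0 = 1
  last : k n = m + 1
  lt : ∀ j ∈ Finset.Icc 1 n, k (j - 1) < k j

/-- The weight `p_j` of the particle compounded from `q_i B(σ_i)`, `k_{j-1} ≤ i < k_j`. -/
noncomputable def blockWeight (q : ℕ → ℝ) (k : ℕ → ℕ) (j : ℕ) : ℝ :=
  ∑ i ∈ Finset.Ico (k (j - 1)) (k j), q i

/-- The crossover probability `ε_j` of the particle compounded from `q_i B(σ_i)`,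
`k_{j-1} ≤ i < k_j`. -/
noncomputable def blockMean (q σ : ℕ → ℝ) (k : ℕ → ℕ) (j : ℕ) : ℝ :=
  (∑ i ∈ Finset.Ico (k (j - 1)) (k j), q i * σ i) / blockWeight q k j

/-- The channel `D⁺_Q(k_1, …, k_{n-1}) = ∑_{j ∈ [n]} p_j B(ε_j)`. -/
noncomputable def blockChannel (n : ℕ) (q σ : ℕ → ℝ) (k : ℕ → ℕ) :
    ZMod 2 → Fin n × ZMod 2 → ℝ :=
  bscMixture n (blockWeight q k) (blockMean q σ k)

/-- `φ(ε₁, ε₂) = ln((1-ε₁)/(1-ε₂)) / ln((1-ε₁)ε₂ / ((1-ε₂)ε₁))`. At `ε₁ = 0` Lean's conventions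
give the value `0`, which is the limit as `ε₁` tends to `0` from the right. -/
noncomputable def phi (ε₁ ε₂ : ℝ) : ℝ :=
  Real.log ((1 - ε₁) / (1 - ε₂)) / Real.log (((1 - ε₁) * ε₂) / ((1 - ε₂) * ε₁))

end SymBIDMC

namespace SymBIDMC

/-! ### Symmetric capacity and likelihood-ratio profiles -/

/-! The capacity of `∑ p_j B(ε_j)` is `∑ p_j (1 - h(ε_j))`. The map `(p, pε) ↦ p h(ε)` is concave
and homogeneous, so when a particle absorbs weight `t` of `B(τ)`, with `t` of either sign, its
entropy term grows by at most `t` times the tangent of `h` at `ε`, read at `τ`. Hence moving weight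
`t` of `B(τ)` from one particle to another of different crossover probability strictly raises the
capacity as soon as the difference of the two tangents at `τ`, times `t`, does not favour the old
position: `mul_bscCapacity_add_lt`.

A fractional splitting weight can be moved slightly in both directions, and one of the two signs
satisfies this slope condition. So no optimal pattern has a fractional weight
(`IsPStarPattern.exists_symmCapacity_lt`).

For block channels, `φ(ε_j, ε_{j+1})` is the abscissa where the two tangents cross (`le_phi_iff`,
`phi_le_iff`), so comparing `σ` at the cut with it tells in which direction a whole particle may be
moved. Since `φ` lies strictly between the two means, a block that satisfies the condition has at
least two particles and is not emptied.

Capacities of equivalent channels agree because the capacity is a function of the likelihood-ratio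
profile (`ChannelEquiv.symmCapacity_eq`); this transfers everything to explicit mixtures. -/

/-- The capacity `1 - h(ε)` of the binary symmetric channel `B(ε)`. -/
noncomputable def bscCapacity (ε : ℝ) : ℝ := 1 - Real.binEntropy ε / Real.log 2

/-- An output with likelihoods `a`, `b` has posterior `a / (a + b)` and behaves like a binary
symmetric channel with that parameter, used with the probability of the output. -/
theorem logb_term_eq_mul_bscCapacity {a b : ℝ} (ha : 0 ≤ a) (hb : 0 ≤ b) :
    (1 / 2 : ℝ) * a * Real.logb 2 (a / ((1 / 2 : ℝ) * a + (1 / 2 : ℝ) * b)) +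
      (1 / 2 : ℝ) * b * Real.logb 2 (b / ((1 / 2 : ℝ) * a + (1 / 2 : ℝ) * b)) =
    (a + b) / 2 * bscCapacity (a / (a + b)) := by
  have h2 : Real.log 2 ≠ 0 := (Real.log_pos one_lt_two).ne'
  rcases ha.eq_or_lt with rfl | ha
  · rcases hb.eq_or_lt with rfl | hb
    · simp
    · simp [bscCapacity, Real.logb]
      field_simp
  rcases hb.eq_or_lt with rfl | hb
  · simp [bscCapacity, Real.logb, ha.ne']
    field_simp
  have hs : a + b ≠ 0 := by positivity
  have h1 : a / ((1 / 2 : ℝ) * a + (1 / 2 : ℝ) * b) = 2 * (a / (a + b)) := by field_simp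
  have h1' : b / ((1 / 2 : ℝ) * a + (1 / 2 : ℝ) * b) = 2 * (b / (a + b)) := by field_simp
  have h3 : 1 - a / (a + b) = b / (a + b) := by field_simp; ring
  rw [h1, h1', bscCapacity, Real.binEntropy_eq_negMulLog_add_negMulLog_one_sub, h3]
  simp only [Real.negMulLog, Real.logb]
  rw [Real.log_mul two_ne_zero (by positivity), Real.log_mul two_ne_zero (by positivity)]
  field_simp
  ring

section Profile
variable {Y : Type*} {W : ZMod 2 → Y → ℝ}

theorem symmCapacity_eq_tsum (hW : IsBIDMC W) :
    symmCapacity W = ∑' y, (W 0 y + W 1 y) / 2 * bscCapacity (W 0 y / (W 0 y + W 1 y)) := by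
  refine tsum_congr fun y => ?_
  rw [← logb_term_eq_mul_bscCapacity (hW.nonneg 0 y) (hW.nonneg 1 y)]
  exact Fin.sum_univ_two _

theorem IsBIDMC.summable_weight (hW : IsBIDMC W) : Summable fun y => (W 0 y + W 1 y) / 2 :=
  ((hW.hasSum_one 0).summable.add (hW.hasSum_one 1).summable).div_const 2

theorem IsBIDMC.weight_nonneg (hW : IsBIDMC W) (y : Y) : 0 ≤ (W 0 y + W 1 y) / 2 := by
  have := hW.nonneg 0 y
  have := hW.nonneg 1 y
  positivity

theorem ratio_eq_iff {y : Y} (hy : W 0 y + W 1 y ≠ 0) (ε : ℝ) :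
    W 0 y * (1 - ε) = W 1 y * ε ↔ W 0 y / (W 0 y + W 1 y) = ε := by
  rw [div_eq_iff hy]
  constructor <;> intro h <;> linarith

theorem IsBIDMC.ratio_mem_Icc (hW : IsBIDMC W) (y : Y) :
    W 0 y / (W 0 y + W 1 y) ∈ Set.Icc (0 : ℝ) 1 := by
  have h0 := hW.nonneg 0 y
  have h1 := hW.nonneg 1 y
  exact ⟨by positivity, div_le_one_of_le₀ (by linarith) (by positivity)⟩

theorem IsBIDMC.weight_le_lrProfile (hW : IsBIDMC W) {y : Y} {ε : ℝ}
    (h : W 0 y * (1 - ε) = W 1 y * ε) : (W 0 y + W 1 y) / 2 ≤ lrProfile W ε :=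
  (hW.summable_weight.subtype {y | W 0 y * (1 - ε) = W 1 y * ε}).le_tsum ⟨y, h⟩
    fun y' _ => hW.weight_nonneg y'.1

/-- Group the outputs by posterior. An output of positive weight has its posterior in `S`, since its
weight is bounded by the profile there; this also covers infinite alphabets. -/
theorem IsBIDMC.symmCapacity_eq_sum_lrProfile (hW : IsBIDMC W) (S : Finset ℝ)
    (hS : ∀ ε ∈ Set.Icc (0 : ℝ) 1, ε ∉ S → lrProfile W ε = 0) :
    symmCapacity W = ∑ ε ∈ S, lrProfile W ε * bscCapacity ε := by
  classical
  have hpt : ∀ y, (W 0 y + W 1 y) / 2 * bscCapacity (W 0 y / (W 0 y + W 1 y)) =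
      ∑ ε ∈ S, Set.indicator {y | W 0 y * (1 - ε) = W 1 y * ε}
        (fun y => (W 0 y + W 1 y) / 2) y * bscCapacity ε := by
    intro y
    by_cases hy : W 0 y + W 1 y = 0
    · simp [Set.indicator_apply, hy]
    have hmem : W 0 y / (W 0 y + W 1 y) ∈ S := by
      by_contra hn
      have h1 := hW.weight_le_lrProfile ((ratio_eq_iff hy _).2 rfl)
      rw [hS _ (hW.ratio_mem_Icc y) hn] at h1
      have := hW.weight_nonneg y
      exact hy (by linarith)
    rw [Finset.sum_eq_single_of_mem _ hmem]
    · rw [Set.indicator_of_mem]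
      exact (ratio_eq_iff hy _).2 rfl
    · intro ε _ hne
      rw [Set.indicator_of_notMem, zero_mul]
      exact fun h => hne ((ratio_eq_iff hy _).1 h).symm
  rw [symmCapacity_eq_tsum hW, tsum_congr hpt, Summable.tsum_finsetSum]
  · refine Finset.sum_congr rfl fun ε _ => ?_
    rw [tsum_mul_right, ← tsum_subtype]
    rfl
  · intro ε _
    exact (hW.summable_weight.indicator _).mul_right _

end Profile

/-- The symmetric capacity is invariant under equivalence with a channel of finite output
alphabet. -/
theorem ChannelEquiv.symmCapacity_eq {Y Y' : Type*} [Fintype Y'] {W : ZMod 2 → Y → ℝ}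
    {W' : ZMod 2 → Y' → ℝ} (hW : IsBIDMC W) (hW' : IsBIDMC W') (h : ChannelEquiv W W') :
    symmCapacity W = symmCapacity W' := by
  classical
  set S : Finset ℝ := Finset.univ.image fun y => W' 0 y / (W' 0 y + W' 1 y)
  have hS : ∀ ε ∈ Set.Icc (0 : ℝ) 1, ε ∉ S → lrProfile W' ε = 0 := by
    intro ε _ hn
    refine (tsum_congr fun y => ?_).trans tsum_zero
    by_contra hne
    refine hn (Finset.mem_image.2 ⟨y.1, Finset.mem_univ _, ?_⟩)
    exact (ratio_eq_iff (fun h0 => hne (by rw [h0, zero_div])) ε).1 y.2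
  rw [hW.symmCapacity_eq_sum_lrProfile S fun ε hε hn => (h ε hε).trans (hS ε hε hn),
    hW'.symmCapacity_eq_sum_lrProfile S hS]
  refine Finset.sum_congr rfl fun ε hε => ?_
  obtain ⟨y, -, rfl⟩ := Finset.mem_image.1 hε
  rw [h _ (hW'.ratio_mem_Icc y)]

theorem sum_fin_succ_eq_sum_Icc (n : ℕ) (f : ℕ → ℝ) :
    ∑ j : Fin n, f (j + 1) = ∑ j ∈ Finset.Icc 1 n, f j := by
  rw [Fin.sum_univ_eq_sum_range (fun j => f (j + 1)), Finset.range_eq_Ico,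
    Finset.sum_Ico_add' f 0 n 1]
  rfl

/-! ### Capacity of a mixture of binary symmetric channels -/

section Mixture
variable {n : ℕ} {p ε : ℕ → ℝ}

theorem bscMixture_add (x : ZMod 2) (j : Fin n) :
    bscMixture n p ε x (j, (0 : ZMod 2)) + bscMixture n p ε x (j, (1 : ZMod 2)) = p (j + 1) := by
  have hx : ∀ x : ZMod 2, x = 0 ∨ x = 1 := by decide
  rcases hx x with rfl | rfl <;> simp [bscMixture, bsc] <;> ring

theorem isBIDMC_bscMixture (hp : ∀ j ∈ Finset.Icc 1 n, 0 ≤ p j)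
    (hε : ∀ j ∈ Finset.Icc 1 n, ε j ∈ Set.Icc (0 : ℝ) 1) (hsum : ∑ j ∈ Finset.Icc 1 n, p j = 1) :
    IsBIDMC (bscMixture n p ε) where
  nonneg x y := by
    have hj : (y.1 : ℕ) + 1 ∈ Finset.Icc 1 n := Finset.mem_Icc.2 ⟨by omega, y.1.2⟩
    have h1 := (hε _ hj).1
    have h2 := (hε _ hj).2
    refine mul_nonneg (hp _ hj) ?_
    unfold bsc
    split_ifs <;> linarith
  hasSum_one x := by
    have key : ∑ y, bscMixture n p ε x y = 1 := by
      rw [Fintype.sum_prod_type, ← hsum, ← sum_fin_succ_eq_sum_Icc]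
      refine Finset.sum_congr rfl fun j _ => ?_
      exact (Fin.sum_univ_two _).trans (bscMixture_add x j)
    exact key ▸ hasSum_fintype _

theorem bscCapacity_one_sub (ε : ℝ) : bscCapacity (1 - ε) = bscCapacity ε := by
  simp [bscCapacity]

/-- The two outputs of the `j`-th particle have posteriors `1 - ε_j` and `ε_j`, each has probability
`p_j / 2`, and `h` is symmetric. -/
theorem symmCapacity_bscMixture (hp : ∀ j ∈ Finset.Icc 1 n, 0 ≤ p j)
    (hε : ∀ j ∈ Finset.Icc 1 n, ε j ∈ Set.Icc (0 : ℝ) 1) (hsum : ∑ j ∈ Finset.Icc 1 n, p j = 1) :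
    symmCapacity (bscMixture n p ε) = ∑ j ∈ Finset.Icc 1 n, p j * bscCapacity (ε j) := by
  rw [symmCapacity_eq_tsum (isBIDMC_bscMixture hp hε hsum), tsum_fintype,
    Fintype.sum_prod_type, ← sum_fin_succ_eq_sum_Icc]
  refine Finset.sum_congr rfl fun j _ => ?_
  refine (Fin.sum_univ_two _).trans ?_
  have e1 : bscMixture n p ε 0 (j, (0 : ZMod 2)) = p (j + 1) * (1 - ε (j + 1)) := by
    simp [bscMixture, bsc]
  have e2 : bscMixture n p ε 1 (j, (0 : ZMod 2)) = p (j + 1) * ε (j + 1) := by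
    simp [bscMixture, bsc]
  have e3 : bscMixture n p ε 0 (j, (1 : ZMod 2)) = p (j + 1) * ε (j + 1) := by
    simp [bscMixture, bsc]
  have e4 : bscMixture n p ε 1 (j, (1 : ZMod 2)) = p (j + 1) * (1 - ε (j + 1)) := by
    simp [bscMixture, bsc]
  change (bscMixture n p ε 0 (j, (0 : ZMod 2)) + bscMixture n p ε 1 (j, (0 : ZMod 2))) / 2 *
      bscCapacity (bscMixture n p ε 0 (j, (0 : ZMod 2)) /
        (bscMixture n p ε 0 (j, (0 : ZMod 2)) + bscMixture n p ε 1 (j, (0 : ZMod 2)))) +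
    (bscMixture n p ε 0 (j, (1 : ZMod 2)) + bscMixture n p ε 1 (j, (1 : ZMod 2))) / 2 *
      bscCapacity (bscMixture n p ε 0 (j, (1 : ZMod 2)) /
        (bscMixture n p ε 0 (j, (1 : ZMod 2)) + bscMixture n p ε 1 (j, (1 : ZMod 2)))) = _
  rw [e1, e2, e3, e4]
  have h5 : p (j + 1) * (1 - ε (j + 1)) + p (j + 1) * ε (j + 1) = p (j + 1) := by ring
  have h6 : p (j + 1) * ε (j + 1) + p (j + 1) * (1 - ε (j + 1)) = p (j + 1) := by ring
  rw [h5, h6]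
  by_cases h0 : p (j + 1) = 0
  · simp [h0]
  rw [mul_div_cancel_left₀ _ h0, mul_div_cancel_left₀ _ h0, bscCapacity_one_sub]
  ring

end Mixture

theorem bscCapacity_nonneg (ε : ℝ) : 0 ≤ bscCapacity ε := by
  have h2 : 0 < Real.log 2 := Real.log_pos one_lt_two
  have := Real.binEntropy_le_log_two (p := ε)
  rw [bscCapacity, sub_nonneg, div_le_one h2]
  exact this

theorem bscCapacity_pos {ε : ℝ} (h : ε ≠ 1 / 2) : 0 < bscCapacity ε := by
  have h2 : 0 < Real.log 2 := Real.log_pos one_lt_two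
  rw [bscCapacity, sub_pos, div_lt_one h2]
  exact Real.binEntropy_lt_log_two.2 (by simpa using h)

/-! ### Moving mass between two particles -/

/-- This is `log u ≤ u - 1` at `u = x / y`, multiplied by `y`. Applied to `(x, y)` and to `(1 - x, 1
- y)`, the right-hand sides cancel, which gives Gibbs' inequality. -/
theorem mul_log_sub_log_le {x y : ℝ} (hx : 0 < x) (hy : 0 ≤ y) :
    y * Real.log x - y * Real.log y ≤ x - y := by
  rcases hy.eq_or_lt with rfl | hy
  · simpa using hx.le
  have := Real.log_le_sub_one_of_pos (div_pos hx hy)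
  rw [Real.log_div hx.ne' hy.ne'] at this
  have h := mul_le_mul_of_nonneg_left this hy.le
  have e : y * (x / y - 1) = x - y := by field_simp
  linarith

theorem mul_log_sub_log_lt {x y : ℝ} (hx : 0 < x) (hy : 0 ≤ y) (hne : x ≠ y) :
    y * Real.log x - y * Real.log y < x - y := by
  rcases hy.eq_or_lt with rfl | hy
  · simpa using hx
  have := Real.log_lt_sub_one_of_pos (div_pos hx hy) (by rwa [Ne, div_eq_one_iff_eq hy.ne'])
  rw [Real.log_div hx.ne' hy.ne'] at this
  have h := mul_lt_mul_of_pos_left this hy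
  have e : y * (x / y - 1) = x - y := by field_simp
  linarith

/-- The tangent of the binary entropy at `x`, evaluated at `y`. -/
noncomputable def entropyTangent (x y : ℝ) : ℝ :=
  -(y * Real.log x + (1 - y) * Real.log (1 - x))

theorem entropyTangent_self (x : ℝ) : entropyTangent x x = Real.binEntropy x := by
  simp only [entropyTangent, Real.binEntropy_eq_negMulLog_add_negMulLog_one_sub, Real.negMulLog]
  ring

theorem binEntropy_le_entropyTangent {x y : ℝ} (hx : x ∈ Set.Ioo (0 : ℝ) 1)
    (hy : y ∈ Set.Icc (0 : ℝ) 1) : Real.binEntropy y ≤ entropyTangent x y := by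
  have h1 := mul_log_sub_log_le hx.1 hy.1
  have h2 := mul_log_sub_log_le (sub_pos.2 hx.2) (sub_nonneg.2 hy.2)
  simp only [entropyTangent, Real.binEntropy_eq_negMulLog_add_negMulLog_one_sub, Real.negMulLog]
  linarith

theorem binEntropy_lt_entropyTangent {x y : ℝ} (hx : x ∈ Set.Ioo (0 : ℝ) 1)
    (hy : y ∈ Set.Icc (0 : ℝ) 1) (hne : x ≠ y) : Real.binEntropy y < entropyTangent x y := by
  have h1 := mul_log_sub_log_lt hx.1 hy.1 hne
  have h2 := mul_log_sub_log_le (sub_pos.2 hx.2) (sub_nonneg.2 hy.2)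
  simp only [entropyTangent, Real.binEntropy_eq_negMulLog_add_negMulLog_one_sub, Real.negMulLog]
  linarith

/-- A particle of weight `p` and crossover probability `ε` absorbs weight `t` of `B(τ)`: the new
contribution to the conditional entropy lies below the tangent. -/
theorem mul_binEntropy_le_of_mean {p ε t τ p' ε' : ℝ} (hε : ε ∈ Set.Ioo (0 : ℝ) 1)
    (hε' : ε' ∈ Set.Icc (0 : ℝ) 1) (hp' : 0 ≤ p') (hw : p' = p + t)
    (hm : p' * ε' = p * ε + t * τ) :
    p' * Real.binEntropy ε' ≤ p * Real.binEntropy ε + t * entropyTangent ε τ := by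
  have h := mul_le_mul_of_nonneg_left (binEntropy_le_entropyTangent hε hε') hp'
  rw [← entropyTangent_self ε]
  have e : p' * entropyTangent ε ε' = p * entropyTangent ε ε + t * entropyTangent ε τ := by
    simp only [entropyTangent]
    -- The tangent is affine, so weight times its value depends linearly on weight and first moment,
    -- and both of these add up.
    linear_combination (-(Real.log ε) + Real.log (1 - ε)) * hm - Real.log (1 - ε) * hw
  linarith

theorem mul_binEntropy_lt_of_mean {p ε t τ p' ε' : ℝ} (hε : ε ∈ Set.Ioo (0 : ℝ) 1)
    (hε' : ε' ∈ Set.Icc (0 : ℝ) 1) (hp' : 0 < p') (hw : p' = p + t)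
    (hm : p' * ε' = p * ε + t * τ) (ht : t ≠ 0) (hτ : τ ≠ ε) :
    p' * Real.binEntropy ε' < p * Real.binEntropy ε + t * entropyTangent ε τ := by
  have hne : ε ≠ ε' := by
    rintro rfl
    have : t * (τ - ε) = 0 := by rw [hw] at hm; linarith
    rcases mul_eq_zero.1 this with h | h
    · exact ht h
    · exact hτ (sub_eq_zero.1 h)
  have h := mul_lt_mul_of_pos_left (binEntropy_lt_entropyTangent hε hε' hne) hp'
  rw [← entropyTangent_self ε]
  have e : p' * entropyTangent ε ε' = p * entropyTangent ε ε + t * entropyTangent ε τ := by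
    simp only [entropyTangent]
    linear_combination (-(Real.log ε) + Real.log (1 - ε)) * hm - Real.log (1 - ε) * hw
  linarith

/-- Moving weight `t` of `B(τ)` from the second particle to the first one. -/
theorem mul_bscCapacity_add_lt {p₁ p₂ ε₁ ε₂ p₁' p₂' ε₁' ε₂' t τ : ℝ}
    (h₁ : ε₁ ∈ Set.Ioo (0 : ℝ) 1) (h₂ : ε₂ ∈ Set.Ioo (0 : ℝ) 1)
    (h₁' : ε₁' ∈ Set.Icc (0 : ℝ) 1) (h₂' : ε₂' ∈ Set.Icc (0 : ℝ) 1)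
    (hp₁ : 0 < p₁') (hp₂ : 0 < p₂') (hw₁ : p₁' = p₁ + t) (hw₂ : p₂' = p₂ - t)
    (hm₁ : p₁' * ε₁' = p₁ * ε₁ + t * τ) (hm₂ : p₂' * ε₂' = p₂ * ε₂ - t * τ)
    (ht : t ≠ 0) (hne : ε₁ ≠ ε₂) (hslope : t * entropyTangent ε₁ τ ≤ t * entropyTangent ε₂ τ) :
    p₁ * bscCapacity ε₁ + p₂ * bscCapacity ε₂ <
      p₁' * bscCapacity ε₁' + p₂' * bscCapacity ε₂' := by
  have key : p₁' * Real.binEntropy ε₁' + p₂' * Real.binEntropy ε₂' <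
      p₁ * Real.binEntropy ε₁ + p₂ * Real.binEntropy ε₂ := by
    -- Losing weight `t` is absorbing weight `-t`; the tangent bound does not need the sign.
    have hw₂' : p₂' = p₂ + -t := by linarith
    have hm₂' : p₂' * ε₂' = p₂ * ε₂ + -t * τ := by linarith
    -- As `ε₁ ≠ ε₂`, the moved `τ` differs from one of them, and that particle yields the strict
    -- inequality.
    by_cases hτ : τ = ε₁
    · have a := mul_binEntropy_le_of_mean h₁ h₁' hp₁.le hw₁ hm₁
      have b := mul_binEntropy_lt_of_mean h₂ h₂' hp₂ hw₂' hm₂' (neg_ne_zero.2 ht)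
        (fun h => hne (hτ.symm.trans h))
      linarith
    · have a := mul_binEntropy_lt_of_mean h₁ h₁' hp₁ hw₁ hm₁ ht hτ
      have b := mul_binEntropy_le_of_mean h₂ h₂' hp₂.le hw₂' hm₂'
      linarith
  have h2 : 0 < Real.log 2 := Real.log_pos one_lt_two
  have := div_lt_div_of_pos_right key h2
  simp only [bscCapacity]
  rw [add_div, add_div] at this
  have e : ∀ a b : ℝ, a * (1 - b / Real.log 2) = a - a * b / Real.log 2 := fun a b => by ring
  rw [e, e, e, e]
  linarith

theorem sum_lt_sum_of_pair {S : Finset ℕ} {f g : ℕ → ℝ} {a b : ℕ} (ha : a ∈ S) (hb : b ∈ S)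
    (hab : a ≠ b) (h : ∀ j ∈ S, j ≠ a → j ≠ b → f j = g j) (hlt : f a + f b < g a + g b) :
    ∑ j ∈ S, f j < ∑ j ∈ S, g j := by
  have hb' : b ∈ S.erase a := Finset.mem_erase.2 ⟨hab.symm, hb⟩
  rw [← Finset.add_sum_erase S f ha, ← Finset.add_sum_erase S g ha,
    ← Finset.add_sum_erase _ f hb', ← Finset.add_sum_erase _ g hb']
  have : ∑ j ∈ (S.erase a).erase b, f j = ∑ j ∈ (S.erase a).erase b, g j :=
    Finset.sum_congr rfl fun j hj => by
      simp only [Finset.mem_erase] at hj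
      exact h j hj.2.2 hj.2.1 hj.1
  linarith

theorem sum_Ioc_telescope (f g : ℕ → ℝ) (i : ℕ → ℕ) (n : ℕ)
    (h : ∀ j ∈ Finset.Icc 1 n, i j ≤ i (j + 1)) :
    ∑ j ∈ Finset.Icc 1 n, (g j - g (j + 1) + ∑ l ∈ Finset.Ioc (i j) (i (j + 1)), f l) =
      g 1 - g (n + 1) + ∑ l ∈ Finset.Ioc (i 1) (i (n + 1)), f l ∧ i 1 ≤ i (n + 1) := by
  induction n with
  | zero => simp
  | succ n ih =>
    have h' : ∀ j ∈ Finset.Icc 1 n, i j ≤ i (j + 1) := fun j hj =>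
      h j (Finset.Icc_subset_Icc_right n.le_succ hj)
    obtain ⟨e, hle⟩ := ih h'
    have hl := h (n + 1) (Finset.mem_Icc.2 ⟨by omega, le_rfl⟩)
    refine ⟨?_, hle.trans hl⟩
    rw [Finset.sum_Icc_succ_top (by omega), e, ← Finset.sum_Ioc_consecutive f hle hl]
    ring

/-! ### Segments -/

/-- Over half-open intervals consecutive segments are disjoint, and the splitting weights appear as
boundary terms that telescope. -/
theorem sum_segCoeff_mul (q g : ℕ → ℝ) {a b : ℕ} (hab : a < b) (t t' : ℝ) :
    ∑ l ∈ Finset.Icc a b, segCoeff q a b t t' l * g l =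
      t * g a - t' * g b + ∑ l ∈ Finset.Ioc a b, q l * g l := by
  rw [← Finset.Ioc_insert_left hab.le, Finset.sum_insert (by simp)]
  have h : ∀ l ∈ Finset.Ioc a b, segCoeff q a b t t' l * g l =
      q l * g l - if l = b then t' * g b else 0 := by
    intro l hl
    have : l ≠ a := (Finset.mem_Ioc.1 hl).1.ne'
    rw [segCoeff, if_neg this]
    split_ifs with h
    · subst h; ring
    · ring
  rw [Finset.sum_congr rfl h, Finset.sum_sub_distrib, Finset.sum_ite_eq',
    if_pos (Finset.mem_Ioc.2 ⟨hab, le_rfl⟩)]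
  simp [segCoeff]
  ring

theorem segWeight_eq (q : ℕ → ℝ) {i : ℕ → ℕ} (s : ℕ → ℝ) {j : ℕ} (h : i j < i (j + 1)) :
    segWeight q i s j = s j - s (j + 1) + ∑ l ∈ Finset.Ioc (i j) (i (j + 1)), q l := by
  simpa [segWeight] using sum_segCoeff_mul q (fun _ => 1) h (s j) (s (j + 1))

theorem segMean_eq (q σ : ℕ → ℝ) {i : ℕ → ℕ} (s : ℕ → ℝ) {j : ℕ} (h : i j < i (j + 1)) :
    segMean q σ i s j = (s j * σ (i j) - s (j + 1) * σ (i (j + 1)) +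
      ∑ l ∈ Finset.Ioc (i j) (i (j + 1)), q l * σ l) / segWeight q i s j := by
  rw [segMean, sum_segCoeff_mul q σ h]

/-- Indices and weights that cut `∑ q_i B(σ_i)` into `n` segments. -/
structure IsSplitting (m n : ℕ) (q : ℕ → ℝ) (i : ℕ → ℕ) (s : ℕ → ℝ) : Prop where
  i_one : i 1 = 0
  s_one : s 1 = 0
  i_last : i (n + 1) = m + 1
  s_last : s (n + 1) = 0
  i_lt : ∀ j ∈ Finset.Icc 1 n, i j < i (j + 1)
  s_nonneg : ∀ j ∈ Finset.Icc 2 n, 0 ≤ s j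
  s_le : ∀ j ∈ Finset.Icc 2 n, s j ≤ q (i j)

theorem IsPStarPattern.isSplitting {m n : ℕ} {q σ : ℕ → ℝ} {i : ℕ → ℕ} {s : ℕ → ℝ}
    (h : IsPStarPattern m n q σ i s) : IsSplitting m n q i s :=
  ⟨h.i_one, h.s_one, h.i_last, h.s_last, h.i_lt, h.s_nonneg, h.s_le⟩

section Splitting
variable {m n : ℕ} {q σ : ℕ → ℝ} {i : ℕ → ℕ} {s : ℕ → ℝ}

theorem IsSplitting.i_le_last (hs : IsSplitting m n q i s) {j : ℕ} (hj : j ∈ Finset.Icc 1 (n + 1)) :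
    i j ≤ m + 1 := by
  rw [Finset.mem_Icc] at hj
  rw [← hs.i_last]
  have : ∀ d, j + d ≤ n + 1 → i j ≤ i (j + d) := by
    intro d
    induction d with
    | zero => simp
    | succ d ih =>
      intro hd
      exact (ih (by omega)).trans (hs.i_lt (j + d) (Finset.mem_Icc.2 (by omega))).le
  simpa [Nat.add_sub_cancel' hj.2] using this (n + 1 - j) (by omega)

theorem IsSplitting.s_mem (hN : IsNormalForm m q σ) (hs : IsSplitting m n q i s) {j : ℕ}
    (hj : j ∈ Finset.Icc 1 (n + 1)) : 0 ≤ s j ∧ s j ≤ q (i j) := by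
  rw [Finset.mem_Icc] at hj
  by_cases h1 : j = 1
  · simp [h1, hs.s_one, hs.i_one, hN.q_zero]
  by_cases h2 : j = n + 1
  · simp [h2, hs.s_last, hs.i_last, hN.q_last]
  have : j ∈ Finset.Icc 2 n := Finset.mem_Icc.2 (by omega)
  exact ⟨hs.s_nonneg j this, hs.s_le j this⟩

theorem IsSplitting.sum_segWeight (hN : IsNormalForm m q σ) (hs : IsSplitting m n q i s) :
    ∑ j ∈ Finset.Icc 1 n, segWeight q i s j = 1 := by
  rw [Finset.sum_congr rfl fun j hj => segWeight_eq q s (hs.i_lt j hj),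
    (sum_Ioc_telescope q s i n fun j hj => (hs.i_lt j hj).le).1, hs.s_one, hs.s_last, hs.i_one,
    hs.i_last, ← hN.q_sum, Finset.sum_Ioc_succ_top (by omega), hN.q_last]
  simp [← Finset.Icc_add_one_left_eq_Ioc]

theorem IsNormalForm.q_nonneg (hN : IsNormalForm m q σ) {l : ℕ} (hl : l ≤ m + 1) : 0 ≤ q l := by
  by_cases h0 : l = 0
  · simp [h0, hN.q_zero]
  by_cases h1 : l = m + 1
  · simp [h1, hN.q_last]
  exact (hN.q_pos l (Finset.mem_Icc.2 (by omega))).le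

theorem IsSplitting.segCoeff_nonneg (hN : IsNormalForm m q σ) (hs : IsSplitting m n q i s) {j : ℕ}
    (hj : j ∈ Finset.Icc 1 n) {l : ℕ} (hl : l ∈ Finset.Icc (i j) (i (j + 1))) :
    0 ≤ segCoeff q (i j) (i (j + 1)) (s j) (s (j + 1)) l := by
  rw [Finset.mem_Icc] at hj hl
  have hj' : j + 1 ∈ Finset.Icc 1 (n + 1) := Finset.mem_Icc.2 (by omega)
  unfold segCoeff
  split_ifs
  · exact (hs.s_mem hN (Finset.mem_Icc.2 (by omega))).1
  · exact sub_nonneg.2 (hs.s_mem hN hj').2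
  · exact hN.q_nonneg (hl.2.trans (hs.i_le_last hj'))

/-- The values `σ 0` and `σ (m + 1)` are unconstrained, so bounds on the means need their
coefficients to vanish. -/
theorem IsSplitting.segCoeff_eq_zero (hN : IsNormalForm m q σ) (hs : IsSplitting m n q i s) {j : ℕ}
    (hj : j ∈ Finset.Icc 1 n) {l : ℕ} (hl : l ∈ Finset.Icc (i j) (i (j + 1)))
    (hlm : l ∉ Finset.Icc 1 m) : segCoeff q (i j) (i (j + 1)) (s j) (s (j + 1)) l = 0 := by
  rw [Finset.mem_Icc] at hj hl
  have hj' : j + 1 ∈ Finset.Icc 1 (n + 1) := Finset.mem_Icc.2 (by omega)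
  have hlast := hs.i_le_last hj'
  have hlt := hs.i_lt j (Finset.mem_Icc.2 hj)
  have hq : q l = 0 := by
    rw [Finset.mem_Icc] at hlm
    rcases (by omega : l = 0 ∨ l = m + 1) with rfl | rfl
    · exact hN.q_zero
    · exact hN.q_last
  unfold segCoeff
  split_ifs with h1 h2
  · have := hs.s_mem hN (j := j) (Finset.mem_Icc.2 (by omega))
    rw [← h1, hq] at this
    linarith
  · have := hs.s_mem hN hj'
    rw [← h2, hq] at this
    rw [← h2, hq]
    linarith
  · exact hq

theorem IsSplitting.segMean_mem_Icc (hN : IsNormalForm m q σ) (hs : IsSplitting m n q i s) {j : ℕ}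
    (hj : j ∈ Finset.Icc 1 n) (hw : 0 < segWeight q i s j) :
    segMean q σ i s j ∈ Set.Icc (0 : ℝ) (1 / 2) := by
  constructor
  · refine div_nonneg (Finset.sum_nonneg fun l hl => ?_) hw.le
    by_cases hlm : l ∈ Finset.Icc 1 m
    · exact mul_nonneg (hs.segCoeff_nonneg hN hj hl) (hN.σ_nonneg l hlm)
    · simp [hs.segCoeff_eq_zero hN hj hl hlm]
  · rw [segMean, div_le_iff₀ hw, segWeight, Finset.mul_sum]
    refine Finset.sum_le_sum fun l hl => ?_
    by_cases hlm : l ∈ Finset.Icc 1 m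
    · rw [mul_comm (1 / 2 : ℝ)]
      exact mul_le_mul_of_nonneg_left (hN.σ_le l hlm) (hs.segCoeff_nonneg hN hj hl)
    · simp [hs.segCoeff_eq_zero hN hj hl hlm]

theorem IsSplitting.isBIDMC_segChannel (hN : IsNormalForm m q σ) (hs : IsSplitting m n q i s)
    (hw : ∀ j ∈ Finset.Icc 1 n, 0 < segWeight q i s j) : IsBIDMC (segChannel n q σ i s) :=
  isBIDMC_bscMixture (fun j hj => (hw j hj).le)
    (fun j hj => Set.Icc_subset_Icc_right (by norm_num) (hs.segMean_mem_Icc hN hj (hw j hj)))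
    (hs.sum_segWeight hN)

theorem IsSplitting.symmCapacity_segChannel (hN : IsNormalForm m q σ)
    (hs : IsSplitting m n q i s) (hw : ∀ j ∈ Finset.Icc 1 n, 0 < segWeight q i s j) :
    symmCapacity (segChannel n q σ i s) =
      ∑ j ∈ Finset.Icc 1 n, segWeight q i s j * bscCapacity (segMean q σ i s j) :=
  symmCapacity_bscMixture (fun j hj => (hw j hj).le)
    (fun j hj => Set.Icc_subset_Icc_right (by norm_num) (hs.segMean_mem_Icc hN hj (hw j hj)))
    (hs.sum_segWeight hN)

end Splitting

theorem ChannelEquiv.refl {Y : Type*} (W : ZMod 2 → Y → ℝ) : ChannelEquiv W W := fun _ _ => rfl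

section Pattern
variable {m n : ℕ} {q σ : ℕ → ℝ} {i : ℕ → ℕ} {s : ℕ → ℝ}

theorem IsPStarPattern.isPStarDegradation (hN : IsNormalForm m q σ)
    (h : IsPStarPattern m n q σ i s) : IsPStarDegradation m n q σ (segChannel n q σ i s) :=
  ⟨h.isSplitting.isBIDMC_segChannel hN h.weight_pos, i, s, h, .refl _⟩

theorem IsPPlusDegradation.isPStarDegradation {Y : Type*} {W : ZMod 2 → Y → ℝ}
    (h : IsPPlusDegradation m n q σ W) : IsPStarDegradation m n q σ W :=
  let ⟨hW, i, s, hp, _, he⟩ := h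
  ⟨hW, i, s, hp, he⟩

end Pattern

/-- With `m ≥ 2` one has `σ 1 < σ 2 ≤ 1 / 2`, so the first particle has positive capacity.
Positivity makes a smaller loss rate the same as a larger capacity. -/
theorem IsNormalForm.symmCapacity_pos {m : ℕ} {q σ : ℕ → ℝ} (hN : IsNormalForm m q σ) (hm : 2 ≤ m)
    {X : Type*} {Q : ZMod 2 → X → ℝ} (hQ : IsBIDMC Q) (he : ChannelEquiv Q (bscMixture m q σ)) :
    0 < symmCapacity Q := by
  have hq : ∀ j ∈ Finset.Icc 1 m, 0 ≤ q j := fun j hj => (hN.q_pos j hj).le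
  have hσ : ∀ j ∈ Finset.Icc 1 m, σ j ∈ Set.Icc (0 : ℝ) 1 := fun j hj =>
    ⟨hN.σ_nonneg j hj, (hN.σ_le j hj).trans (by norm_num)⟩
  rw [he.symmCapacity_eq hQ (isBIDMC_bscMixture hq hσ hN.q_sum),
    symmCapacity_bscMixture hq hσ hN.q_sum]
  have h1 : 1 ∈ Finset.Icc 1 m := Finset.mem_Icc.2 (by omega)
  refine Finset.sum_pos' (fun j hj => mul_nonneg (hq j hj) (bscCapacity_nonneg _))
    ⟨1, h1, mul_pos (hN.q_pos 1 h1) (bscCapacity_pos ?_)⟩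
  have h2 := hN.σ_lt 1 2 le_rfl (by omega) hm
  have h3 := hN.σ_le 2 (Finset.mem_Icc.2 (by omega))
  linarith

theorem clr_lt_clr {X Y Y' : Type*} {Q : ZMod 2 → X → ℝ} {W : ZMod 2 → Y → ℝ}
    {W' : ZMod 2 → Y' → ℝ} (hQ : 0 < symmCapacity Q) (h : symmCapacity W < symmCapacity W') :
    clr Q W' < clr Q W :=
  div_lt_div_of_pos_right (by linarith) hQ

/-! ### Perturbation of a fractional splitting weight -/

section Perturb
variable {m n : ℕ} {q σ : ℕ → ℝ} {i : ℕ → ℕ} {s : ℕ → ℝ}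

open Filter Topology

theorem IsPStarPattern.mean_pos (h : IsPStarPattern m n q σ i s) (hN : IsNormalForm m q σ) {j : ℕ}
    (hj : j ∈ Finset.Icc 2 n) : 0 < segMean q σ i s j := by
  rw [Finset.mem_Icc] at hj
  have h1 := h.mean_lt (j - 1) (Finset.mem_Ico.2 (by omega))
  have hj1 : j - 1 ∈ Finset.Icc 1 n := Finset.mem_Icc.2 (by omega)
  rw [Nat.sub_add_cancel (by omega)] at h1
  exact (h.isSplitting.segMean_mem_Icc hN hj1 (h.weight_pos _ hj1)).1.trans_lt h1

/-- The tangent at the left mean exists only if that mean is positive. If the split particle were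
the first one, the left segment would be the first, with adjacent ends, and `adjacent_left` would
force `s (j + 1) = 0`. Otherwise the split particle is noisy and leaves positive weight in the left
segment. -/
theorem IsPStarPattern.mean_pred_pos_of_fractional (h : IsPStarPattern m n q σ i s)
    (hN : IsNormalForm m q σ) {j : ℕ} (hj : j + 1 ∈ Finset.Icc 2 n) (h0 : s (j + 1) ≠ 0)
    (hq : s (j + 1) ≠ q (i (j + 1))) : 0 < segMean q σ i s j := by
  have hs := h.isSplitting
  have hj1 : j ∈ Finset.Icc 1 n := by rw [Finset.mem_Icc] at hj ⊢; omega
  rw [Finset.mem_Icc] at hj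
  have hlt := h.i_lt j hj1
  have hlt' := h.i_lt (j + 1) (Finset.mem_Icc.2 (by omega))
  have hle := hs.i_le_last (j := j + 1 + 1) (Finset.mem_Icc.2 (by omega))
  have hi : i (j + 1) ≠ 1 := by
    intro hi
    have hj' : j = 1 := by
      by_contra hne
      have := h.i_lt (j - 1) (Finset.mem_Icc.2 (by omega))
      rw [Nat.sub_add_cancel (by omega)] at this
      omega
    subst hj'
    exact h0 (h.adjacent_left 1 hj1 (by rw [hi, h.i_one]) h.s_one).1
  have hσ : 0 < σ (i (j + 1)) := by
    have a := hN.σ_lt 1 (i (j + 1)) le_rfl (by omega) (by omega)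
    have b := hN.σ_nonneg 1 (Finset.mem_Icc.2 (by omega))
    linarith
  refine div_pos ?_ (h.weight_pos j hj1)
  refine Finset.sum_pos' (fun l hl => ?_) ⟨i (j + 1), Finset.mem_Icc.2 ⟨hlt.le, le_rfl⟩, ?_⟩
  · by_cases hlm : l ∈ Finset.Icc 1 m
    · exact mul_nonneg (hs.segCoeff_nonneg hN hj1 hl) (hN.σ_nonneg l hlm)
    · simp [hs.segCoeff_eq_zero hN hj1 hl hlm]
  · refine mul_pos ?_ hσ
    have := hs.s_le (j + 1) (Finset.mem_Icc.2 hj)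
    simp only [segCoeff, hlt.ne', if_false, if_true, sub_pos]
    exact lt_of_le_of_ne this hq

/-- Strict conditions persist by continuity. The adjacency conditions at the two segments meeting at
`k` never apply, because they would involve or force an extreme value of `s k`; the other segments
do not change. -/
theorem IsPStarPattern.eventually_update (h : IsPStarPattern m n q σ i s)
    (hN : IsNormalForm m q σ) {k : ℕ} (hk : k ∈ Finset.Icc 2 n) (h0 : s k ≠ 0)
    (hq : s k ≠ q (i k)) :
    ∀ᶠ δ in 𝓝 (0 : ℝ), IsPStarPattern m n q σ i (Function.update s k (s k - δ)) := by
  have hk' := Finset.mem_Icc.1 hk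
  have hu : ∀ j, ContinuousAt (fun δ : ℝ => Function.update s k (s k - δ) j) 0 := by
    intro j
    by_cases hj : j = k
    · subst hj
      simp only [Function.update_self]
      fun_prop
    · simp only [Function.update_of_ne hj]
      fun_prop
  have hu0 : Function.update s k (s k - 0) = s := by simp
  have hw : ∀ j ∈ Finset.Icc 1 n,
      ContinuousAt (fun δ : ℝ => segWeight q i (Function.update s k (s k - δ)) j) 0 := by
    intro j hj
    simp only [segWeight_eq q _ (h.i_lt j hj)]
    exact ((hu j).sub (hu (j + 1))).add continuousAt_const
  have hm : ∀ j ∈ Finset.Icc 1 n,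
      ContinuousAt (fun δ : ℝ => segMean q σ i (Function.update s k (s k - δ)) j) 0 := by
    intro j hj
    simp only [segMean_eq q σ _ (h.i_lt j hj)]
    refine ContinuousAt.div ((((hu j).mul continuousAt_const).sub
      ((hu (j + 1)).mul continuousAt_const)).add continuousAt_const) (hw j hj) ?_
    rw [hu0]
    exact (h.weight_pos j hj).ne'
  have e1 : ∀ᶠ δ in 𝓝 (0 : ℝ), ∀ j ∈ Finset.Icc 1 n,
      0 < segWeight q i (Function.update s k (s k - δ)) j := by
    refine (Finset.eventually_all _).2 fun j hj => ?_
    refine (hw j hj).eventually_const_lt ?_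
    beta_reduce
    rw [hu0]
    exact h.weight_pos j hj
  have e2 : ∀ᶠ δ in 𝓝 (0 : ℝ), ∀ j ∈ Finset.Ico 1 n,
      segMean q σ i (Function.update s k (s k - δ)) j <
        segMean q σ i (Function.update s k (s k - δ)) (j + 1) := by
    refine (Finset.eventually_all _).2 fun j hj => ?_
    have hj' := Finset.mem_Ico.1 hj
    refine (hm j (Finset.mem_Icc.2 (by omega))).eventually_lt
      (hm (j + 1) (Finset.mem_Icc.2 (by omega))) ?_
    rw [hu0]
    exact h.mean_lt j hj
  have hpos : 0 < s k := lt_of_le_of_ne (h.s_nonneg k hk) h0.symm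
  have hlt : s k < q (i k) := lt_of_le_of_ne (h.s_le k hk) hq
  have e3 : ∀ᶠ δ in 𝓝 (0 : ℝ), 0 < s k - δ :=
    (by fun_prop : ContinuousAt (fun δ : ℝ => s k - δ) 0).eventually_const_lt (by simpa)
  have e4 : ∀ᶠ δ in 𝓝 (0 : ℝ), s k - δ < q (i k) :=
    (by fun_prop : ContinuousAt (fun δ : ℝ => s k - δ) 0).eventually_lt_const (by simpa)
  filter_upwards [e1, e2, e3, e4] with δ e1 e2 e3 e4
  have hs : IsSplitting m n q i (Function.update s k (s k - δ)) :=
    { i_one := h.i_one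
      s_one := by rw [Function.update_of_ne (by omega), h.s_one]
      i_last := h.i_last
      s_last := by rw [Function.update_of_ne (by omega), h.s_last]
      i_lt := h.i_lt
      s_nonneg := fun j hj => by
        by_cases hjk : j = k
        · subst hjk; simpa using e3.le
        · rw [Function.update_of_ne hjk]; exact h.s_nonneg j hj
      s_le := fun j hj => by
        by_cases hjk : j = k
        · subst hjk; simpa using e4.le
        · rw [Function.update_of_ne hjk]; exact h.s_le j hj }
  have h1 : 1 ∈ Finset.Icc 1 n := Finset.mem_Icc.2 (by omega)
  have hn : n ∈ Finset.Icc 1 n := Finset.mem_Icc.2 (by omega)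
  -- The bounds `0` and `1 / 2` on the means are not open conditions, but hold for every splitting
  -- with positive weights.
  refine ⟨hs.i_one, hs.s_one, hs.i_last, hs.s_last, hs.i_lt, hs.s_nonneg, hs.s_le, e1,
    (hs.segMean_mem_Icc hN h1 (e1 1 h1)).1, e2, (hs.segMean_mem_Icc hN hn (e1 n hn)).2, ?_, ?_⟩
  · intro j hj hadj hj0
    by_cases hjk : j = k
    · subst hjk; simp only [Function.update_self] at hj0; exact absurd hj0 e3.ne'
    rw [Function.update_of_ne hjk] at hj0
    have := h.adjacent_left j hj hadj hj0
    by_cases hjk' : j + 1 = k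
    · subst hjk'; exact absurd this.1 h0
    · simpa only [segMean_eq q σ _ (h.i_lt j hj), segWeight_eq q _ (h.i_lt j hj),
        Function.update_of_ne hjk, Function.update_of_ne hjk'] using this
  · intro j hj hadj hj0
    by_cases hjk' : j + 1 = k
    · subst hjk'; simp only [Function.update_self] at hj0; exact absurd hj0 e4.ne
    rw [Function.update_of_ne hjk'] at hj0
    have := h.adjacent_right j hj hadj hj0
    by_cases hjk : j = k
    · subst hjk; exact absurd this.1 hq
    · simpa only [segMean_eq q σ _ (h.i_lt j hj), segWeight_eq q _ (h.i_lt j hj),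
        Function.update_of_ne hjk, Function.update_of_ne hjk'] using this

/-- A fractional splitting weight can be perturbed to a pattern of larger capacity. -/
theorem IsPStarPattern.exists_symmCapacity_lt (h : IsPStarPattern m n q σ i s)
    (hN : IsNormalForm m q σ) {k : ℕ} (hk : k ∈ Finset.Icc 2 n) (h0 : s k ≠ 0)
    (hq : s k ≠ q (i k)) :
    ∃ s', IsPStarPattern m n q σ i s' ∧
      symmCapacity (segChannel n q σ i s) < symmCapacity (segChannel n q σ i s') := by
  have hk' := Finset.mem_Icc.1 hk
  obtain ⟨j, rfl⟩ : ∃ j, k = j + 1 := ⟨k - 1, by omega⟩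
  have hj : j ∈ Finset.Icc 1 n := Finset.mem_Icc.2 (by omega)
  have hj1 : j + 1 ∈ Finset.Icc 1 n := Finset.mem_Icc.2 (by omega)
  have hs := h.isSplitting
  set τ := σ (i (j + 1))
  -- Lowering `s (j + 1)` by `t` hands weight `t` to segment `j`. The sign of `t` is chosen by the
  -- slope condition, its size by the neighbourhood of admissible perturbations.
  obtain ⟨t, ht, hslope, hp⟩ : ∃ t : ℝ, t ≠ 0 ∧
      t * entropyTangent (segMean q σ i s j) τ ≤ t * entropyTangent (segMean q σ i s (j + 1)) τ ∧
      IsPStarPattern m n q σ i (Function.update s (j + 1) (s (j + 1) - t)) := by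
    have hev := h.eventually_update hN hk h0 hq
    obtain ⟨r, hr, hball⟩ := Metric.eventually_nhds_iff.1 hev
    rcases le_total (entropyTangent (segMean q σ i s j) τ)
      (entropyTangent (segMean q σ i s (j + 1)) τ) with hle | hle
    · refine ⟨r / 2, by positivity, mul_le_mul_of_nonneg_left hle (by positivity), hball ?_⟩
      rw [Real.dist_eq, sub_zero, abs_of_pos (by positivity)]
      linarith
    · refine ⟨-(r / 2), neg_ne_zero.2 (by positivity),
        mul_le_mul_of_nonpos_left hle (by linarith), hball ?_⟩
      rw [Real.dist_eq, sub_zero, abs_neg, abs_of_pos (by positivity)]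
      linarith
  refine ⟨_, hp, ?_⟩
  have hs' := hp.isSplitting
  have hmem := fun l hl => hs.segMean_mem_Icc hN hl (h.weight_pos l hl)
  have hmem' := fun l hl => hs'.segMean_mem_Icc hN hl (hp.weight_pos l hl)
  rw [hs.symmCapacity_segChannel hN h.weight_pos, hs'.symmCapacity_segChannel hN hp.weight_pos]
  have hmom : ∀ (s : ℕ → ℝ) (l : ℕ), l ∈ Finset.Icc 1 n → 0 < segWeight q i s l →
      segWeight q i s l * segMean q σ i s l = s l * σ (i l) - s (l + 1) * σ (i (l + 1)) +
        ∑ a ∈ Finset.Ioc (i l) (i (l + 1)), q a * σ a := by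
    intro s l hl hw
    rw [segMean_eq q σ s (h.i_lt l hl), mul_div_cancel₀ _ hw.ne']
  refine sum_lt_sum_of_pair hj hj1 (by omega) ?_ ?_
  · intro l hl hlj hlj1
    have hl1 : l + 1 ≠ j + 1 := by omega
    simp only [segMean_eq q σ _ (h.i_lt l hl), segWeight_eq q _ (h.i_lt l hl),
      Function.update_of_ne hlj1, Function.update_of_ne hl1]
  · have hne : j ≠ j + 1 := by omega
    have hne' : j + 1 + 1 ≠ j + 1 := by omega
    refine mul_bscCapacity_add_lt (t := t) (τ := τ)
      ⟨h.mean_pred_pos_of_fractional hN hk h0 hq, (hmem j hj).2.trans_lt (by norm_num)⟩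
      ⟨h.mean_pos hN hk, (hmem _ hj1).2.trans_lt (by norm_num)⟩
      (Set.Icc_subset_Icc_right (by norm_num) (hmem' j hj))
      (Set.Icc_subset_Icc_right (by norm_num) (hmem' _ hj1))
      (hp.weight_pos j hj) (hp.weight_pos _ hj1) ?_ ?_ ?_ ?_ ht
      (h.mean_lt j (Finset.mem_Ico.2 (by omega))).ne hslope
    · simp only [segWeight_eq q _ (h.i_lt j hj), Function.update_self, Function.update_of_ne hne]
      ring
    · simp only [segWeight_eq q _ (h.i_lt _ hj1), Function.update_self, Function.update_of_ne hne']
      ring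
    · rw [hmom _ j hj (hp.weight_pos j hj), hmom _ j hj (h.weight_pos j hj)]
      simp only [Function.update_self, Function.update_of_ne hne]
      ring
    · rw [hmom _ _ hj1 (hp.weight_pos _ hj1), hmom _ _ hj1 (h.weight_pos _ hj1)]
      simp only [Function.update_self, Function.update_of_ne hne']
      ring

theorem IsCOptimal.splitting_integral (hN : IsNormalForm m q σ) {X Y : Type*}
    {Q : ZMod 2 → X → ℝ} (hQ : 0 < symmCapacity Q) {W : ZMod 2 → Y → ℝ}
    (hW : IsCOptimal m n q σ Q W) (h : IsPStarPattern m n q σ i s)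
    (he : ChannelEquiv W (segChannel n q σ i s)) {j : ℕ} (hj : j ∈ Finset.Icc 2 n) :
    s j = 0 ∨ s j = q (i j) := by
  by_contra hcon
  rw [not_or] at hcon
  obtain ⟨s', hp, hlt⟩ := h.exists_symmCapacity_lt hN hj hcon.1 hcon.2
  rw [← he.symmCapacity_eq hW.1.1 (h.isSplitting.isBIDMC_segChannel hN h.weight_pos)] at hlt
  exact (hW.2 _ _ (hp.isPStarDegradation hN)).not_gt (clr_lt_clr hQ hlt)

end Perturb

/-! ### The crossing point of two entropy tangents -/

section Phi
variable {a b τ : ℝ}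

theorem phi_zero_left (b : ℝ) : phi 0 b = 0 := by simp [phi]

theorem phi_aux (ha : 0 < a) (hab : a < b) (hb : b < 1) :
    phi a b = (Real.log (1 - a) - Real.log (1 - b)) /
        ((Real.log (1 - a) - Real.log (1 - b)) + (Real.log b - Real.log a)) ∧
      0 < (Real.log (1 - a) - Real.log (1 - b)) + (Real.log b - Real.log a) := by
  have h1 := Real.log_lt_log (by linarith : 0 < 1 - b) (by linarith : 1 - b < 1 - a)
  have h2 := Real.log_lt_log ha hab
  have hb0 : b ≠ 0 := by linarith
  have ha1 : 1 - a ≠ 0 := by linarith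
  have hb1 : 1 - b ≠ 0 := by linarith
  refine ⟨?_, by linarith⟩
  rw [phi, Real.log_div ha1 hb1, Real.log_div (mul_ne_zero ha1 hb0) (mul_ne_zero hb1 ha.ne'),
    Real.log_mul ha1 hb0, Real.log_mul hb1 ha.ne']
  congr 1
  ring

/-- The difference of the two tangents is affine in `τ`; its slope is the positive denominator of
`phi a b`, and it vanishes at `phi a b`. -/
theorem le_phi_iff (ha : 0 < a) (hab : a < b) (hb : b < 1) :
    τ ≤ phi a b ↔ entropyTangent a τ ≤ entropyTangent b τ := by
  obtain ⟨e, hpos⟩ := phi_aux ha hab hb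
  rw [e, le_div_iff₀ hpos, entropyTangent, entropyTangent]
  constructor <;> intro h <;> linarith

theorem phi_le_iff (ha : 0 < a) (hab : a < b) (hb : b < 1) :
    phi a b ≤ τ ↔ entropyTangent b τ ≤ entropyTangent a τ := by
  obtain ⟨e, hpos⟩ := phi_aux ha hab hb
  rw [e, div_le_iff₀ hpos, entropyTangent, entropyTangent]
  constructor <;> intro h <;> linarith

/-- At `b` the tangent at `a` lies strictly above `h(b)`, which is the value of the tangent at `b`;
so the crossing is further left. -/
theorem phi_lt_right (ha : 0 < a) (hab : a < b) (hb : b < 1) : phi a b < b := by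
  by_contra! h
  have h1 := (le_phi_iff ha hab hb).1 h
  have h2 := binEntropy_lt_entropyTangent (x := a) (y := b) ⟨ha, by linarith⟩
    ⟨by linarith, hb.le⟩ hab.ne
  rw [entropyTangent_self] at h1
  linarith

theorem left_lt_phi (ha : 0 < a) (hab : a < b) (hb : b < 1) : a < phi a b := by
  by_contra! h
  have h1 := (phi_le_iff ha hab hb).1 h
  have h2 := binEntropy_lt_entropyTangent (x := b) (y := a) ⟨by linarith, hb⟩
    ⟨ha.le, by linarith⟩ hab.ne'
  rw [entropyTangent_self] at h1
  linarith

end Phi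

/-! ### Block channels -/

section Block
variable {m n : ℕ} {q σ : ℕ → ℝ} {k : ℕ → ℕ}

theorem IsCutSequence.one_le (hk : IsCutSequence m n k) {j : ℕ} (hj : j ≤ n) : 1 ≤ k j := by
  induction j with
  | zero => exact hk.zero.ge
  | succ j ih =>
    have := hk.lt (j + 1) (Finset.mem_Icc.2 (by omega))
    have := ih (by omega)
    simp only [Nat.add_sub_cancel] at *
    omega

theorem IsCutSequence.le_last (hk : IsCutSequence m n k) {j : ℕ} (hj : j ≤ n) : k j ≤ m + 1 := by
  induction hj using Nat.decreasingInduction with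
  | self => exact hk.last.le
  | of_succ j hj ih =>
    have := hk.lt (j + 1) (Finset.mem_Icc.2 (by omega))
    simp only [Nat.add_sub_cancel] at this
    omega

theorem IsCutSequence.blockWeight_pos (hN : IsNormalForm m q σ) (hk : IsCutSequence m n k) {j : ℕ}
    (hj : j ∈ Finset.Icc 1 n) : 0 < blockWeight q k j := by
  have hlt := hk.lt j hj
  rw [Finset.mem_Icc] at hj
  have h1 := hk.one_le (j := j - 1) (by omega)
  have h2 := hk.le_last hj.2
  refine Finset.sum_pos (fun l hl => hN.q_pos l ?_) (Finset.nonempty_Ico.2 hlt)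
  rw [Finset.mem_Ico] at hl
  exact Finset.mem_Icc.2 (by omega)

theorem IsCutSequence.weight_mul_mean (hN : IsNormalForm m q σ) (hk : IsCutSequence m n k) {j : ℕ}
    (hj : j ∈ Finset.Icc 1 n) : blockWeight q k j * blockMean q σ k j =
      ∑ l ∈ Finset.Ico (k (j - 1)) (k j), q l * σ l := by
  rw [blockMean, mul_div_cancel₀ _ (hk.blockWeight_pos hN hj).ne']

theorem IsNormalForm.σ_mono (hN : IsNormalForm m q σ) {l l' : ℕ} (h1 : 1 ≤ l) (h : l ≤ l')
    (h2 : l' ≤ m) : σ l ≤ σ l' := by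
  rcases h.eq_or_lt with rfl | h
  · exact le_rfl
  · exact (hN.σ_lt l l' h1 h h2).le

theorem IsCutSequence.blockMean_le (hN : IsNormalForm m q σ) (hk : IsCutSequence m n k) {j : ℕ}
    (hj : j ∈ Finset.Icc 1 n) : blockMean q σ k j ≤ σ (k j - 1) := by
  rw [blockMean, div_le_iff₀ (hk.blockWeight_pos hN hj), blockWeight, Finset.mul_sum]
  rw [Finset.mem_Icc] at hj
  have h1 := hk.one_le (j := j - 1) (by omega)
  have h2 := hk.le_last hj.2
  refine Finset.sum_le_sum fun l hl => ?_
  rw [Finset.mem_Ico] at hl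
  rw [mul_comm]
  exact mul_le_mul_of_nonneg_right (hN.σ_mono (by omega) (by omega) (by omega))
    (hN.q_nonneg (by omega))

theorem IsCutSequence.le_blockMean (hN : IsNormalForm m q σ) (hk : IsCutSequence m n k) {j : ℕ}
    (hj : j ∈ Finset.Icc 1 n) : σ (k (j - 1)) ≤ blockMean q σ k j := by
  rw [blockMean, le_div_iff₀ (hk.blockWeight_pos hN hj), blockWeight, Finset.mul_sum]
  rw [Finset.mem_Icc] at hj
  have h1 := hk.one_le (j := j - 1) (by omega)
  have h2 := hk.le_last hj.2
  refine Finset.sum_le_sum fun l hl => ?_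
  rw [Finset.mem_Ico] at hl
  rw [mul_comm]
  exact mul_le_mul_of_nonneg_left (hN.σ_mono (by omega) (by omega) (by omega))
    (hN.q_nonneg (by omega))

theorem IsCutSequence.blockMean_lt (hN : IsNormalForm m q σ) (hk : IsCutSequence m n k) {j : ℕ}
    (hj : j ∈ Finset.Ico 1 n) : blockMean q σ k j < blockMean q σ k (j + 1) := by
  rw [Finset.mem_Ico] at hj
  have h1 := hk.blockMean_le hN (j := j) (Finset.mem_Icc.2 (by omega))
  have h2 := hk.le_blockMean hN (j := j + 1) (Finset.mem_Icc.2 (by omega))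
  have h3 := hk.lt j (Finset.mem_Icc.2 (by omega))
  have h4 := hk.lt (j + 1) (Finset.mem_Icc.2 (by omega))
  have h5 := hk.one_le (j := j - 1) (by omega)
  have h6 := hk.le_last (j := j + 1) (by omega)
  rw [Nat.add_sub_cancel] at h2 h4
  have h7 := hN.σ_lt (k j - 1) (k j) (by omega) (by omega) (by omega)
  linarith

theorem IsCutSequence.blockMean_mem (hN : IsNormalForm m q σ) (hk : IsCutSequence m n k) {j : ℕ}
    (hj : j ∈ Finset.Icc 1 n) : blockMean q σ k j ∈ Set.Icc (0 : ℝ) (1 / 2) := by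
  have h1 := hk.blockMean_le hN hj
  have h2 := hk.le_blockMean hN hj
  have h3 := hk.lt j hj
  rw [Finset.mem_Icc] at hj
  have h5 := hk.one_le (j := j - 1) (by omega)
  have h6 := hk.le_last hj.2
  exact ⟨(hN.σ_nonneg _ (Finset.mem_Icc.2 (by omega))).trans h2,
    h1.trans (hN.σ_le _ (Finset.mem_Icc.2 (by omega)))⟩

/-- The indices of the splitting patterns that put every particle into the block to its left. -/
def blockIndex (m n : ℕ) (k : ℕ → ℕ) (j : ℕ) : ℕ := if j = n + 1 then m + 1 else k (j - 1) - 1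

theorem IsCutSequence.blockIndex_lt (hk : IsCutSequence m n k) {j : ℕ} (hj : j ∈ Finset.Icc 1 n) :
    blockIndex m n k j < blockIndex m n k (j + 1) := by
  have h1 := hk.lt j hj
  rw [Finset.mem_Icc] at hj
  have h2 := hk.one_le (j := j - 1) (by omega)
  have h3 := hk.le_last hj.2
  unfold blockIndex
  rw [if_neg (by omega), Nat.add_sub_cancel]
  split_ifs <;> omega

theorem IsCutSequence.sum_Ioc_blockIndex (hN : IsNormalForm m q σ) (hk : IsCutSequence m n k)
    (g : ℕ → ℝ) {j : ℕ} (hj : j ∈ Finset.Icc 1 n) :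
    ∑ l ∈ Finset.Ioc (blockIndex m n k j) (blockIndex m n k (j + 1)), q l * g l =
      ∑ l ∈ Finset.Ico (k (j - 1)) (k j), q l * g l := by
  have h1 := hk.lt j hj
  rw [Finset.mem_Icc] at hj
  have h2 := hk.one_le (j := j - 1) (by omega)
  have h3 := hk.le_last hj.2
  unfold blockIndex
  rw [if_neg (by omega), Nat.add_sub_cancel]
  split_ifs with h
  -- The last segment ends at `m + 1` instead of `m`; the extra term has `q (m + 1) = 0`.
  · obtain rfl : j = n := by omega
    rw [hk.last, Finset.sum_Ioc_succ_top (by have := hk.last; omega), hN.q_last, zero_mul,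
      add_zero]
    refine Finset.sum_congr ?_ fun _ _ => rfl
    ext l
    simp only [Finset.mem_Ioc, Finset.mem_Ico]
    omega
  · refine Finset.sum_congr ?_ fun _ _ => rfl
    ext l
    simp only [Finset.mem_Ioc, Finset.mem_Ico]
    omega

theorem IsCutSequence.segWeight_blockIndex (hN : IsNormalForm m q σ) (hk : IsCutSequence m n k)
    {j : ℕ} (hj : j ∈ Finset.Icc 1 n) :
    segWeight q (blockIndex m n k) (fun _ => 0) j = blockWeight q k j := by
  rw [segWeight_eq q _ (hk.blockIndex_lt hj)]
  simpa [blockWeight] using hk.sum_Ioc_blockIndex hN (fun _ => 1) hj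

theorem IsCutSequence.segMean_blockIndex (hN : IsNormalForm m q σ) (hk : IsCutSequence m n k)
    {j : ℕ} (hj : j ∈ Finset.Icc 1 n) :
    segMean q σ (blockIndex m n k) (fun _ => 0) j = blockMean q σ k j := by
  rw [segMean_eq q σ _ (hk.blockIndex_lt hj), hk.sum_Ioc_blockIndex hN σ hj,
    hk.segWeight_blockIndex hN hj, blockMean]
  simp

theorem IsCutSequence.isPStarPattern (hN : IsNormalForm m q σ) (hn : 1 ≤ n)
    (hk : IsCutSequence m n k) : IsPStarPattern m n q σ (blockIndex m n k) fun _ => 0 where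
  i_one := by
    rw [blockIndex, if_neg (by omega), Nat.sub_self, hk.zero]
  s_one := rfl
  i_last := if_pos rfl
  s_last := rfl
  i_lt _ hj := hk.blockIndex_lt hj
  s_nonneg _ _ := le_rfl
  s_le j hj := by
    rw [Finset.mem_Icc] at hj
    rw [blockIndex, if_neg (by omega)]
    have := hk.le_last (j := j - 1) (by omega)
    exact hN.q_nonneg (by omega)
  weight_pos j hj := by
    rw [hk.segWeight_blockIndex hN hj]
    exact hk.blockWeight_pos hN hj
  mean_nonneg := by
    have h1 : 1 ∈ Finset.Icc 1 n := Finset.mem_Icc.2 (by omega)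
    rw [hk.segMean_blockIndex hN h1]
    exact (hk.blockMean_mem hN h1).1
  mean_lt j hj := by
    have hj' := Finset.mem_Ico.1 hj
    rw [hk.segMean_blockIndex hN (Finset.mem_Icc.2 (by omega)),
      hk.segMean_blockIndex hN (Finset.mem_Icc.2 (by omega))]
    exact hk.blockMean_lt hN hj
  mean_le := by
    have h1 : n ∈ Finset.Icc 1 n := Finset.mem_Icc.2 (by omega)
    rw [hk.segMean_blockIndex hN h1]
    exact (hk.blockMean_mem hN h1).2
  adjacent_left j hj hadj _ := by
    have hw : segWeight q (blockIndex m n k) (fun _ => 0) j =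
        q (blockIndex m n k (j + 1)) := by
      rw [segWeight_eq q _ (hk.blockIndex_lt hj), hadj]
      simp
    refine ⟨rfl, hw, ?_⟩
    have hpos := hk.blockWeight_pos hN hj
    rw [← hk.segWeight_blockIndex hN hj, hw] at hpos
    rw [segMean_eq q σ _ (hk.blockIndex_lt hj), hw, div_eq_iff hpos.ne', hadj]
    simp [mul_comm]
  -- The premise would make the single particle of the segment weightless.
  adjacent_right j hj hadj h0 := by
    have hpos := hk.blockWeight_pos hN hj
    rw [← hk.segWeight_blockIndex hN hj, segWeight_eq q _ (hk.blockIndex_lt hj), hadj] at hpos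
    rw [hadj] at h0
    simp [← h0] at hpos

theorem bscMixture_congr {p p' ε ε' : ℕ → ℝ} (hp : ∀ j ∈ Finset.Icc 1 n, p j = p' j)
    (hε : ∀ j ∈ Finset.Icc 1 n, ε j = ε' j) : bscMixture n p ε = bscMixture n p' ε' := by
  funext x y
  have hj : (y.1 : ℕ) + 1 ∈ Finset.Icc 1 n := Finset.mem_Icc.2 ⟨by omega, y.1.2⟩
  simp only [bscMixture, hp _ hj, hε _ hj]

theorem IsCutSequence.segChannel_blockIndex (hN : IsNormalForm m q σ) (hk : IsCutSequence m n k) :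
    segChannel n q σ (blockIndex m n k) (fun _ => 0) = blockChannel n q σ k :=
  bscMixture_congr (fun _ hj => hk.segWeight_blockIndex hN hj)
    fun _ hj => hk.segMean_blockIndex hN hj

theorem IsCutSequence.isPPlusDegradation (hN : IsNormalForm m q σ) (hn : 1 ≤ n)
    (hk : IsCutSequence m n k) : IsPPlusDegradation m n q σ (blockChannel n q σ k) := by
  have hp := hk.isPStarPattern hN hn
  rw [← hk.segChannel_blockIndex hN]
  exact ⟨hp.isSplitting.isBIDMC_segChannel hN hp.weight_pos, _, _, hp, fun _ _ => .inl rfl,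
    .refl _⟩

theorem IsCutSequence.symmCapacity_blockChannel (hN : IsNormalForm m q σ) (hn : 1 ≤ n)
    (hk : IsCutSequence m n k) : symmCapacity (blockChannel n q σ k) =
      ∑ j ∈ Finset.Icc 1 n, blockWeight q k j * bscCapacity (blockMean q σ k j) := by
  have hp := hk.isPStarPattern hN hn
  rw [← hk.segChannel_blockIndex hN, hp.isSplitting.symmCapacity_segChannel hN hp.weight_pos]
  exact Finset.sum_congr rfl fun j hj => by
    rw [hk.segWeight_blockIndex hN hj, hk.segMean_blockIndex hN hj]

/-! ### Shifting one cut -/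

/-- Moving the `j`-th cut, such that weight `t` of `B(τ)` moves from block `j + 1` to block `j`. -/
theorem IsCutSequence.symmCapacity_lt_update (hN : IsNormalForm m q σ) (hk : IsCutSequence m n k)
    {j c : ℕ} (hj : j ∈ Finset.Ico 1 n) (hk' : IsCutSequence m n (Function.update k j c))
    {t τ : ℝ} (ht : t ≠ 0) (hpos : 0 < blockMean q σ k j)
    (hslope : t * entropyTangent (blockMean q σ k j) τ ≤
      t * entropyTangent (blockMean q σ k (j + 1)) τ)
    (hw₁ : ∑ l ∈ Finset.Ico (k (j - 1)) c, q l = ∑ l ∈ Finset.Ico (k (j - 1)) (k j), q l + t)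
    (hw₂ : ∑ l ∈ Finset.Ico c (k (j + 1)), q l = ∑ l ∈ Finset.Ico (k j) (k (j + 1)), q l - t)
    (hm₁ : ∑ l ∈ Finset.Ico (k (j - 1)) c, q l * σ l =
      ∑ l ∈ Finset.Ico (k (j - 1)) (k j), q l * σ l + t * τ)
    (hm₂ : ∑ l ∈ Finset.Ico c (k (j + 1)), q l * σ l =
      ∑ l ∈ Finset.Ico (k j) (k (j + 1)), q l * σ l - t * τ) :
    symmCapacity (blockChannel n q σ k) <
      symmCapacity (blockChannel n q σ (Function.update k j c)) := by
  have hj' := Finset.mem_Ico.1 hj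
  have hj0 : j ∈ Finset.Icc 1 n := Finset.mem_Icc.2 (by omega)
  have hj1 : j + 1 ∈ Finset.Icc 1 n := Finset.mem_Icc.2 (by omega)
  have hm0 := hk.blockMean_mem hN hj0
  have hm1 := hk.blockMean_mem hN hj1
  have hm0' := hk'.blockMean_mem hN hj0
  have hm1' := hk'.blockMean_mem hN hj1
  have hlt := hk.blockMean_lt hN hj
  have ne0 : j - 1 ≠ j := by omega
  have ne1 : j + 1 ≠ j := by omega
  rw [hk.symmCapacity_blockChannel hN (by omega), hk'.symmCapacity_blockChannel hN (by omega)]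
  refine sum_lt_sum_of_pair hj0 hj1 (by omega) ?_ ?_
  · intro l hl hlj hlj1
    rw [Finset.mem_Icc] at hl
    have ne2 : l - 1 ≠ j := by omega
    simp only [blockMean, blockWeight, Function.update_of_ne hlj, Function.update_of_ne ne2]
  · refine mul_bscCapacity_add_lt (t := t) (τ := τ)
      ⟨hpos, hm0.2.trans_lt (by norm_num)⟩
      ⟨hpos.trans hlt, hm1.2.trans_lt (by norm_num)⟩
      (Set.Icc_subset_Icc_right (by norm_num) hm0')
      (Set.Icc_subset_Icc_right (by norm_num) hm1')
      (hk'.blockWeight_pos hN hj0) (hk'.blockWeight_pos hN hj1) ?_ ?_ ?_ ?_ ht hlt.ne hslope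
    · simpa only [blockWeight, Function.update_self, Function.update_of_ne ne0] using hw₁
    · simpa only [blockWeight, Function.update_self, Function.update_of_ne ne1,
        Nat.add_sub_cancel] using hw₂
    · rw [hk.weight_mul_mean hN hj0, hk'.weight_mul_mean hN hj0]
      simpa only [Function.update_self, Function.update_of_ne ne0] using hm₁
    · rw [hk.weight_mul_mean hN hj1, hk'.weight_mul_mean hN hj1]
      simpa only [Function.update_self, Function.update_of_ne ne1, Nat.add_sub_cancel] using hm₂

theorem IsCutSequence.update (hk : IsCutSequence m n k) {j c : ℕ} (hj : j ∈ Finset.Ico 1 n)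
    (h1 : k (j - 1) < c) (h2 : c < k (j + 1)) : IsCutSequence m n (Function.update k j c) where
  zero := by
    rw [Finset.mem_Ico] at hj
    rw [Function.update_of_ne (by omega), hk.zero]
  last := by
    rw [Finset.mem_Ico] at hj
    rw [Function.update_of_ne (by omega), hk.last]
  lt l hl := by
    rw [Finset.mem_Ico] at hj
    have := hk.lt l hl
    rw [Finset.mem_Icc] at hl
    by_cases hlj : l = j
    · subst hlj
      rwa [Function.update_self, Function.update_of_ne (by omega)]
    by_cases hlj' : l = j + 1
    · subst hlj'
      rwa [Nat.add_sub_cancel, Function.update_self, Function.update_of_ne (by omega)]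
    · rwa [Function.update_of_ne hlj, Function.update_of_ne (by omega)]

theorem IsCutSequence.isBetter_update (hN : IsNormalForm m q σ) (hk : IsCutSequence m n k)
    {X : Type*} {Q : ZMod 2 → X → ℝ} (hQ : 0 < symmCapacity Q)
    {j c : ℕ} (hj : j ∈ Finset.Ico 1 n) (hk' : IsCutSequence m n (Function.update k j c))
    (hlt : symmCapacity (blockChannel n q σ k) <
      symmCapacity (blockChannel n q σ (Function.update k j c))) :
    IsCutSequence m n (Function.update k j c) ∧
      IsPPlusDegradation m n q σ (blockChannel n q σ (Function.update k j c)) ∧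
      IsBetter m n q σ Q (blockChannel n q σ (Function.update k j c)) (blockChannel n q σ k) := by
  have hn : 1 ≤ n := by rw [Finset.mem_Ico] at hj; omega
  have hp := hk'.isPPlusDegradation hN hn
  exact ⟨hk', hp, hp.isPStarDegradation, (hk.isPPlusDegradation hN hn).isPStarDegradation,
    clr_lt_clr hQ hlt⟩

theorem IsCutSequence.better_of_le_phi (hN : IsNormalForm m q σ) (hk : IsCutSequence m n k)
    {X : Type*} {Q : ZMod 2 → X → ℝ} (hQ : 0 < symmCapacity Q)
    {j : ℕ} (hj : j ∈ Finset.Ico 1 n)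
    (hphi : σ (k j) ≤ phi (blockMean q σ k j) (blockMean q σ k (j + 1))) :
    IsCutSequence m n (Function.update k j (k j + 1)) ∧
      IsPPlusDegradation m n q σ (blockChannel n q σ (Function.update k j (k j + 1))) ∧
      IsBetter m n q σ Q (blockChannel n q σ (Function.update k j (k j + 1)))
        (blockChannel n q σ k) := by
  have hj' := Finset.mem_Ico.1 hj
  have hj0 : j ∈ Finset.Icc 1 n := Finset.mem_Icc.2 (by omega)
  have hj1 : j + 1 ∈ Finset.Icc 1 n := Finset.mem_Icc.2 (by omega)
  have hl0 := hk.lt j hj0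
  have hl1 := hk.lt (j + 1) hj1
  rw [Nat.add_sub_cancel] at hl1
  have ho := hk.one_le (j := j - 1) (by omega)
  have hl := hk.le_last (j := j + 1) (by omega)
  have hlt := hk.blockMean_lt hN hj
  have hhalf := (hk.blockMean_mem hN hj1).2
  -- A zero mean gives `phi = 0`, hence `σ (k j) ≤ 0`; but `k j > 1`, so `σ (k j) > σ 1 ≥ 0`.
  have hpos : 0 < blockMean q σ k j := by
    refine lt_of_le_of_ne (hk.blockMean_mem hN hj0).1 fun h => ?_
    rw [← h, phi_zero_left] at hphi
    have a := hN.σ_lt 1 (k j) le_rfl (by omega) (by omega)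
    have b := hN.σ_nonneg 1 (Finset.mem_Icc.2 (by omega))
    linarith
  have hb1 : blockMean q σ k (j + 1) < 1 := by linarith
  -- Otherwise block `j + 1` is the single particle `k j`, whose `σ` exceeds `phi`.
  have hc : k j + 1 < k (j + 1) := by
    by_contra hcon
    have h1 := phi_lt_right hpos hlt hb1
    have h2 := hk.blockMean_le hN hj1
    rw [show k (j + 1) - 1 = k j by omega] at h2
    linarith
  have hk' := hk.update hj (by omega : k (j - 1) < k j + 1) hc
  have hq := hN.q_pos (k j) (Finset.mem_Icc.2 (by omega))
  refine hk.isBetter_update hN hQ hj hk' ?_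
  refine hk.symmCapacity_lt_update hN hj hk' (t := q (k j)) (τ := σ (k j)) hq.ne' hpos
    (mul_le_mul_of_nonneg_left ((le_phi_iff hpos hlt hb1).1 hphi) hq.le) ?_ ?_ ?_ ?_
  · rw [Finset.sum_Ico_succ_top hl0.le]
  · rw [Finset.sum_eq_sum_Ico_succ_bot hl1]; ring
  · rw [Finset.sum_Ico_succ_top hl0.le]
  · rw [Finset.sum_eq_sum_Ico_succ_bot hl1]; ring

theorem IsCutSequence.better_of_phi_le (hN : IsNormalForm m q σ) (hk : IsCutSequence m n k)
    {X : Type*} {Q : ZMod 2 → X → ℝ} (hQ : 0 < symmCapacity Q)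
    {j : ℕ} (hj : j ∈ Finset.Ico 1 n)
    (hphi : phi (blockMean q σ k j) (blockMean q σ k (j + 1)) ≤ σ (k j - 1))
    (hsum : 0 < blockMean q σ k j + σ (k j - 1)) :
    IsCutSequence m n (Function.update k j (k j - 1)) ∧
      IsPPlusDegradation m n q σ (blockChannel n q σ (Function.update k j (k j - 1))) ∧
      IsBetter m n q σ Q (blockChannel n q σ (Function.update k j (k j - 1)))
        (blockChannel n q σ k) := by
  have hj' := Finset.mem_Ico.1 hj
  have hj0 : j ∈ Finset.Icc 1 n := Finset.mem_Icc.2 (by omega)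
  have hj1 : j + 1 ∈ Finset.Icc 1 n := Finset.mem_Icc.2 (by omega)
  have hl0 := hk.lt j hj0
  have hl1 := hk.lt (j + 1) hj1
  rw [Nat.add_sub_cancel] at hl1
  have ho := hk.one_le (j := j - 1) (by omega)
  have hl := hk.le_last (j := j + 1) (by omega)
  have hlt := hk.blockMean_lt hN hj
  have hhalf := (hk.blockMean_mem hN hj1).2
  -- A zero mean would make every `σ` in the block vanish, including the last, against `hsum`. The
  -- excluded case is a block consisting of one noiseless particle, where `phi = 0` meets the bound
  -- but the shift would empty the block.
  have hpos : 0 < blockMean q σ k j := by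
    refine (hk.blockMean_mem hN hj0).1.lt_of_ne fun h => ?_
    have hterm : ∀ l ∈ Finset.Ico (k (j - 1)) (k j), 0 ≤ q l * σ l := fun l hl => by
      rw [Finset.mem_Ico] at hl
      exact mul_nonneg (hN.q_nonneg (by omega)) (hN.σ_nonneg l (Finset.mem_Icc.2 (by omega)))
    have e := hk.weight_mul_mean hN hj0
    rw [← h, mul_zero, eq_comm, Finset.sum_eq_zero_iff_of_nonneg hterm] at e
    have h1 := e (k j - 1) (Finset.mem_Ico.2 (by omega))
    have h2 := hN.q_pos (k j - 1) (Finset.mem_Icc.2 (by omega))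
    rw [← h, zero_add] at hsum
    exact (mul_pos h2 hsum).ne' h1
  have hb1 : blockMean q σ k (j + 1) < 1 := by linarith
  have hc : k (j - 1) < k j - 1 := by
    by_contra hcon
    have h1 := left_lt_phi hpos hlt hb1
    have h2 := hk.le_blockMean hN hj0
    rw [show k (j - 1) = k j - 1 by omega] at h2
    linarith
  have hk' := hk.update hj hc (by omega : k j - 1 < k (j + 1))
  have hq := hN.q_pos (k j - 1) (Finset.mem_Icc.2 (by omega))
  refine hk.isBetter_update hN hQ hj hk' ?_
  have hleft : ∀ g : ℕ → ℝ, ∑ l ∈ Finset.Ico (k (j - 1)) (k j), g l =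
      ∑ l ∈ Finset.Ico (k (j - 1)) (k j - 1), g l + g (k j - 1) := fun g => by
    rw [← Finset.sum_Ico_succ_top hc.le, Nat.sub_add_cancel (by omega)]
  have hright : ∀ g : ℕ → ℝ, ∑ l ∈ Finset.Ico (k j - 1) (k (j + 1)), g l =
      g (k j - 1) + ∑ l ∈ Finset.Ico (k j) (k (j + 1)), g l := fun g => by
    rw [Finset.sum_eq_sum_Ico_succ_bot (by omega), Nat.sub_add_cancel (by omega)]
  -- Moving the last particle of block `j` to the right is a move of negative weight to the left,
  -- which reverses the slope condition.
  refine hk.symmCapacity_lt_update hN hj hk' (t := -q (k j - 1)) (τ := σ (k j - 1))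
    (neg_ne_zero.2 hq.ne') hpos
    (mul_le_mul_of_nonpos_left ((phi_le_iff hpos hlt hb1).1 hphi) (by linarith)) ?_ ?_ ?_ ?_
  · rw [hleft]; ring
  · rw [hright]; ring
  · rw [hleft]; ring
  · rw [hright]; ring

end Block

end SymBIDMC

theorem corollary3 (m n : ℕ) (hn : 2 ≤ n) (hnm : n < m) (q σ : ℕ → ℝ)
    (hqσ : SymBIDMC.IsNormalForm m q σ)
    {X : Type*} (Q : ZMod 2 → X → ℝ) (hQ : SymBIDMC.IsBIDMC Q)
    (hQe : SymBIDMC.ChannelEquiv Q (SymBIDMC.bscMixture m q σ)) :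
    (∀ (Y : Type*) (W : ZMod 2 → Y → ℝ), SymBIDMC.IsCOptimal m n q σ Q W →
      SymBIDMC.IsPPlusDegradation m n q σ W ∧
      ∀ (i : ℕ → ℕ) (s : ℕ → ℝ), SymBIDMC.IsPStarPattern m n q σ i s →
        SymBIDMC.ChannelEquiv W (SymBIDMC.segChannel n q σ i s) →
        ∀ j ∈ Finset.Icc 2 n, s j = 0 ∨ s j = q (i j)) ∧
    (∀ k : ℕ → ℕ, SymBIDMC.IsCutSequence m n k → ∀ j ∈ Finset.Ico 1 n,
      (σ (k j) ≤ SymBIDMC.phi (SymBIDMC.blockMean q σ k j) (SymBIDMC.blockMean q σ k (j + 1)) →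
        SymBIDMC.IsCutSequence m n (Function.update k j (k j + 1)) ∧
        SymBIDMC.IsPPlusDegradation m n q σ
          (SymBIDMC.blockChannel n q σ (Function.update k j (k j + 1))) ∧
        SymBIDMC.IsBetter m n q σ Q
          (SymBIDMC.blockChannel n q σ (Function.update k j (k j + 1)))
          (SymBIDMC.blockChannel n q σ k)) ∧
      (SymBIDMC.phi (SymBIDMC.blockMean q σ k j) (SymBIDMC.blockMean q σ k (j + 1))
            ≤ σ (k j - 1) →
        0 < SymBIDMC.blockMean q σ k j + σ (k j - 1) →
        SymBIDMC.IsCutSequence m n (Function.update k j (k j - 1)) ∧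
        SymBIDMC.IsPPlusDegradation m n q σ
          (SymBIDMC.blockChannel n q σ (Function.update k j (k j - 1))) ∧
        SymBIDMC.IsBetter m n q σ Q
          (SymBIDMC.blockChannel n q σ (Function.update k j (k j - 1)))
          (SymBIDMC.blockChannel n q σ k))) := by
  have hpos := hqσ.symmCapacity_pos (by omega) hQ hQe
  refine ⟨fun Y W hW => ?_, fun k hk j hj => ⟨?_, ?_⟩⟩
  · have hint : ∀ (i : ℕ → ℕ) (s : ℕ → ℝ), SymBIDMC.IsPStarPattern m n q σ i s →
        SymBIDMC.ChannelEquiv W (SymBIDMC.segChannel n q σ i s) →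
        ∀ j ∈ Finset.Icc 2 n, s j = 0 ∨ s j = q (i j) :=
      fun i s hp he j hj => hW.splitting_integral hqσ hpos hp he hj
    obtain ⟨hB, i, s, hp, he⟩ := hW.1
    exact ⟨⟨hB, i, s, hp, hint i s hp he, he⟩, hint⟩
  · exact hk.better_of_le_phi hqσ hpos hj
  · exact hk.better_of_phi_le hqσ hpos hj
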